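/- Let $X$ be a simplicial scheme such that every $X_m$ is locally Noetherian. Fix a set of separably closed fields $\Omega_i$ ($i\in I$) that is large enough: for every $m$, the residue field of every point of $X_m$ embeds in some $\Omega_i$. A *geometric point* of a scheme $Y$ is a map $\operatorname{Spec}\Omega_i\to Y$ for some $i\in I$; a map of schemes $h:Y\to Y'$ sends a geometric point $y$ of $Y$ to the geometric point $h(y)=h\circ y$ of $Y'$. A *rigid cover* of a scheme $Y$ is a map $f:U\to Y$ together with a decomposition $U=\coprod_y U_y$ indexed by the geometric points $y$ of $Y$, with each $U_y$ connected and each $U_y\to Y$ étale and separated, and a geometric point $u_y$ of each $U_y$ with $f(u_y)=y$. A *rigid cover map* from $U\to Y$ to $U'\to Y'$ over $h:Y\to Y'$ is a map $U\to U'$ over $h$ that, for each $y$, sends $U_y$ into $U'_{h(y)}$ and $u_y$ to $u'_{h(y)}$. A *rigid hypercover* of a scheme $Y$ is an augmented simplicial scheme $U$ with $U_{-1}=Y$, together with the structure of a rigid cover on the canonical map $U_n\to(\operatorname{cosk}^Y_{n-1}U)_n$ for every $n\ge 0$ (for $n=0$ this is the map $U_0\to Y$), such that the degeneracy maps preserve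 basepoints: if $u$ is a basepoint of $U_n$, then $s_i(u)$ is the basepoint of $U_{n+1}$ over the image of $s_i(u)$ in $(\operatorname{cosk}^Y_{n}U)_{n+1}$. A *rigid hypercover map* $U\to U'$ is a map of augmented simplicial schemes such that for every $n\geq 0$ the map $U_n\to U'_n$ is a rigid cover map over $(\operatorname{cosk}_{n-1}^{Y}U)_n\to(\operatorname{cosk}_{n-1}^{Y'}U')_n$. A *rigid hypercover of the simplicial scheme* $X$ is an augmented bisimplicial scheme $U$ with $U_{\bullet,-1}=X$ such that each $U_{m,\bullet}$ is a rigid hypercover of $X_m$ and each structure map $U_{m,\bullet}\to U_{k,\bullet}$ (for $[k]\to[m]$) is a rigid hypercover map over $X_m\to X_k$; a map of rigid hypercovers of $X$ is a map of augmented bisimplicial schemes over $X$ that is a rigid hypercover map in each degree $m$. Write $\mathrm{HRR}(X)$ and $\mathrm{HRR}(X_m)$ for the categories of rigid hypercovers of $X$ and of $X_m$ (with maps over $X$, respectively over $X_m$). Then for every $n\ge 0$ the forgetful functor $$\mathrm{HRR}(X)\longrightarrow \mathrm{HRR}(X_0)\times \mathrm{HRR}(X_1)\times\cdots\times \mathrm{HRR}(X_n),\qquad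 U\mapsto (U_{0,\bullet},\dots,U_{n,\bullet}),$$ is cofinal. Here a functor $F:\mathcal C\to\mathcal D$ between categories used to index inverse systems is cofinal if for every object $d$ of $\mathcal D$ the category of pairs $(c,\,F(c)\to d)$ is non-empty and connected. -/

import Mathlib

open CategoryTheory CategoryTheory.Limits Opposite AlgebraicGeometry

universe u

namespace RigidHyper

/-! ### Coskeleta of augmented simplicial schemes -/

/-- An augmented simplicial scheme: a functor from the opposite of the category of the ordinals
`[-1], [0], [1], …` to schemes. -/
abbrev AugSimplicialScheme := AugmentedSimplexCategoryᵒᵖ ⥤ Scheme.{u}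

/-- The object `[n]`, `n ≥ 0`, of the augmented simplex category. -/
abbrev ord (n : ℕ) : AugmentedSimplexCategory :=
  WithInitial.of (SimplexCategory.mk n)

/-- The objects `[k]` with `-1 ≤ k < n` of the augmented simplex category
(`WithInitial.star` is `[-1]`). -/
def below (n : ℕ) : ObjectProperty AugmentedSimplexCategory
  | .of k => k.len < n
  | .star => True

/-- The inclusion of the full subcategory on the objects `[k]` with `-1 ≤ k < n`, on opposite
categories. Restriction along it is the skeleton functor `sk_{n-1}` of augmented objects. -/
abbrev belowIncl (n : ℕ) :
    (below n).FullSubcategoryᵒᵖ ⥤ AugmentedSimplexCategoryᵒᵖ :=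
  (below n).ι.op

instance (a b : AugmentedSimplexCategory) : Finite (a ⟶ b) := by
  cases a with
  | star => exact Finite.of_subsingleton (α := PUnit)
  | of a =>
    cases b with
    | star => exact Finite.of_subsingleton (α := PEmpty)
    | of b => exact inferInstanceAs (Finite (a ⟶ b))

instance (n : ℕ) : Finite (below n).FullSubcategory := by
  let f : Option (Fin n) → (below n).FullSubcategory := fun k =>
    match k with
    | none => ⟨.star, trivial⟩
    | some k => ⟨.of (SimplexCategory.mk k), k.2⟩
  refine Finite.of_surjective f ?_
  rintro ⟨x, hx⟩
  cases x with
  | star => exact ⟨none, rfl⟩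
  | of k => exact ⟨some ⟨k.len, hx⟩, rfl⟩

instance (n m : ℕ) : Finite (StructuredArrow (op (ord m)) (belowIncl n)) := by
  let f : (Σ k : (below n).FullSubcategory, k.obj ⟶ ord m) →
      StructuredArrow (op (ord m)) (belowIncl n) :=
    fun k => StructuredArrow.mk (Y := op k.1) k.2.op
  exact Finite.of_surjective f fun x => ⟨⟨x.right.unop, x.hom.unop⟩, rfl⟩

instance (n m : ℕ) (x y : StructuredArrow (op (ord m)) (belowIncl n)) : Finite (x ⟶ y) := by
  have : Finite (y.right.unop.obj ⟶ x.right.unop.obj) := inferInstance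
  refine Finite.of_injective (fun f : x ⟶ y => f.right.unop.hom) fun f g h => ?_
  apply StructuredArrow.ext
  apply Quiver.Hom.unop_inj
  exact ObjectProperty.hom_ext _ h

noncomputable instance (n m : ℕ) : FinCategory (StructuredArrow (op (ord m)) (belowIncl n)) where
  fintypeObj := Fintype.ofFinite _
  fintypeHom _ _ := Fintype.ofFinite _

/-- The diagram of all `A_k` indexed by the maps `[k] ⟶ [n]` with `-1 ≤ k < n`. -/
abbrev coskDiagram (A : AugSimplicialScheme.{u}) (n : ℕ) :
    StructuredArrow (op (ord n)) (belowIncl n) ⥤ Scheme.{u} :=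
  StructuredArrow.proj (op (ord n)) (belowIncl n) ⋙ belowIncl n ⋙ A

/-- The scheme `(cosk^X_{n-1} A)_n`, where `X = A_{-1}`: the value at `[n]` of the right Kan
extension (right adjoint of restriction) of the restriction of `A` to the `[k]` with `k < n`.
Since the indices include `[-1]`, this limit of schemes is the limit in schemes over `X`, and for
`n = 0` it is `X`. -/
noncomputable def cosk (A : AugSimplicialScheme.{u}) (n : ℕ) : Scheme.{u} :=
  limit (coskDiagram A n)

/-- The canonical map `A_n ⟶ (cosk^X_{n-1} A)_n`. -/
noncomputable def toCosk (A : AugSimplicialScheme.{u}) (n : ℕ) :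
    A.obj (op (ord n)) ⟶ cosk A n :=
  limit.lift (coskDiagram A n)
    { pt := A.obj (op (ord n))
      π :=
        { app := fun j => A.map j.hom
          naturality := fun j k f => by
            refine (Category.id_comp _).trans ?_
            exact (congrArg A.map (StructuredArrow.w f).symm).trans (A.map_comp _ _) } }

/-- The map `(cosk^X_{n-1} A)_n ⟶ (cosk^Y_{n-1} B)_n` induced by a map `A ⟶ B` of augmented
simplicial schemes. -/
noncomputable def coskMap {A B : AugSimplicialScheme.{u}} (g : A ⟶ B) (n : ℕ) :
    cosk A n ⟶ cosk B n :=
  limMap (Functor.whiskerLeft (StructuredArrow.proj (op (ord n)) (belowIncl n))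
    (Functor.whiskerLeft (belowIncl n) g))

lemma coskMap_id (A : AugSimplicialScheme.{u}) (n : ℕ) : coskMap (𝟙 A) n = 𝟙 _ := by
  apply limit.hom_ext
  intro j
  simp [coskMap, cosk]

lemma coskMap_comp {A B C : AugSimplicialScheme.{u}} (g : A ⟶ B) (h : B ⟶ C) (n : ℕ) :
    coskMap (g ≫ h) n = coskMap g n ≫ coskMap h n := by
  apply limit.hom_ext
  intro j
  simp [coskMap, cosk]

/-! ### Rigid covers -/

variable {I : Type u} (Ω : I → Type u) [∀ i, Field (Ω i)]

/-- The geometric points of a scheme `X`: the maps `Spec (Ω i) ⟶ X`, for a fixed family `Ω` of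
separably closed fields. Fixing the fields makes the image of a geometric point under an arbitrary
map of schemes a geometric point. -/
structure GeomPt (X : Scheme.{u}) : Type u where
  i : I
  hom : Spec (CommRingCat.of (Ω i)) ⟶ X

variable {Ω}

/-- The image of a geometric point under a map of schemes. -/
noncomputable def GeomPt.map {X Y : Scheme.{u}} (f : X ⟶ Y) (x : GeomPt Ω X) : GeomPt Ω Y :=
  ⟨x.i, x.hom ≫ f⟩

lemma GeomPt.map_id {X : Scheme.{u}} (x : GeomPt Ω X) : x.map (𝟙 X) = x := by
  simp [GeomPt.map]

lemma GeomPt.map_comp {X Y Z : Scheme.{u}} (f : X ⟶ Y) (g : Y ⟶ Z) (x : GeomPt Ω X) :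
    x.map (f ≫ g) = (x.map f).map g := by
  rw [GeomPt.map, GeomPt.map, GeomPt.map, Category.assoc]

variable (Ω)

/-- The structure of a rigid cover on a map `f : U ⟶ X`: a decomposition of `U` as a coproduct of
connected schemes `U_x`, étale and separated over `X`, indexed by the geometric points `x` of `X`,
and a geometric point `u_x` of each `U_x` over `x`. -/
structure RigidCover {U X : Scheme.{u}} (f : U ⟶ X) where
  component : GeomPt Ω X → Scheme.{u}
  ι (x : GeomPt Ω X) : component x ⟶ U
  isCoproduct : Nonempty (IsColimit (Cofan.mk U ι))
  connected (x : GeomPt Ω X) : ConnectedSpace (component x)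
  etale (x : GeomPt Ω X) : Etale (ι x ≫ f)
  separated (x : GeomPt Ω X) : IsSeparated (ι x ≫ f)
  base (x : GeomPt Ω X) : GeomPt Ω (component x)
  base_map (x : GeomPt Ω X) : (base x).map (ι x ≫ f) = x

variable {Ω}

/-- The basepoint `u_x`, as a geometric point of `U`. -/
noncomputable def RigidCover.pt {U X : Scheme.{u}} {f : U ⟶ X} (c : RigidCover Ω f) (x : GeomPt Ω X) :
    GeomPt Ω U :=
  (c.base x).map (c.ι x)

/-- The pair `g : U ⟶ U'`, `h : X ⟶ X'` is a map of rigid covers: the square commutes, and `g`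
maps each `U_x` to `U'_{h(x)}` preserving basepoints. -/
def IsRigidCoverMap {U X U' X' : Scheme.{u}} {f : U ⟶ X} {f' : U' ⟶ X'}
    (c : RigidCover Ω f) (c' : RigidCover Ω f') (g : U ⟶ U') (h : X ⟶ X') : Prop :=
  g ≫ f' = f ≫ h ∧
    ∀ x : GeomPt Ω X, ∃ gx : c.component x ⟶ c'.component (x.map h),
      gx ≫ c'.ι (x.map h) = c.ι x ≫ g ∧ (c.base x).map gx = c'.base (x.map h)

lemma IsRigidCoverMap.id {U X : Scheme.{u}} {f : U ⟶ X} (c : RigidCover Ω f) :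
    IsRigidCoverMap c c (𝟙 U) (𝟙 X) := by
  refine ⟨by simp, fun x => ?_⟩
  rw [GeomPt.map_id]
  exact ⟨𝟙 _, by simp, GeomPt.map_id _⟩

lemma IsRigidCoverMap.comp {U X U' X' U'' X'' : Scheme.{u}} {f : U ⟶ X} {f' : U' ⟶ X'}
    {f'' : U'' ⟶ X''} {c : RigidCover Ω f} {c' : RigidCover Ω f'} {c'' : RigidCover Ω f''}
    {g : U ⟶ U'} {h : X ⟶ X'} {g' : U' ⟶ U''} {h' : X' ⟶ X''}
    (H : IsRigidCoverMap c c' g h) (H' : IsRigidCoverMap c' c'' g' h') :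
    IsRigidCoverMap c c'' (g ≫ g') (h ≫ h') := by
  refine ⟨by rw [Category.assoc, H'.1, reassoc_of% H.1], fun x => ?_⟩
  obtain ⟨a, ha, ha'⟩ := H.2 x
  obtain ⟨b, hb, hb'⟩ := H'.2 (x.map h)
  rw [GeomPt.map_comp]
  exact ⟨a ≫ b, by rw [Category.assoc, hb, reassoc_of% ha], by rw [GeomPt.map_comp, ha', hb']⟩

/-! ### Rigid hypercovers -/

variable (Ω)

/-- A rigid hypercover (of the scheme in degree `-1`): an augmented simplicial scheme `U` with the
structure of a rigid cover on each `U_n ⟶ (cosk^X_{n-1} U)_n`, `n ≥ 0`, such that the degeneracy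
maps `s_i : U_n ⟶ U_{n+1}` preserve basepoints: they map a basepoint `u` of `U_n` to the basepoint
over the image of `s_i(u)` in `(cosk^X_n U)_{n+1}`. -/
structure RigidHypercover where
  U : AugSimplicialScheme.{u}
  cover (n : ℕ) : RigidCover Ω (toCosk U n)
  degeneracy (n : ℕ) (i : Fin (n + 1)) (x : GeomPt Ω (cosk U n)) :
    let s : U.obj (op (ord n)) ⟶ U.obj (op (ord (n + 1))) :=
      U.map (WithInitial.incl.map (SimplexCategory.σ i)).op
    (cover (n + 1)).pt ((((cover n).pt x).map s).map (toCosk U (n + 1))) =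
      ((cover n).pt x).map s

/-- A rigid hypercover map: a map of augmented simplicial schemes such that each `U_n ⟶ U'_n` is a
rigid cover map over the induced map of coskeleta. -/
@[ext]
structure RigidHypercover.Hom (V W : RigidHypercover.{u} Ω) where
  map : V.U ⟶ W.U
  rigid (n : ℕ) :
    IsRigidCoverMap (V.cover n) (W.cover n) (map.app (op (ord n))) (coskMap map n)

instance : Category (RigidHypercover.{u} Ω) where
  Hom V W := RigidHypercover.Hom Ω V W
  id V := ⟨𝟙 V.U, fun n => by rw [coskMap_id]; exact IsRigidCoverMap.id _⟩
  comp f g := ⟨f.map ≫ g.map, fun n => by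
    rw [coskMap_comp]; exact (f.rigid n).comp (g.rigid n)⟩
  id_comp _ := RigidHypercover.Hom.ext (Category.id_comp _)
  comp_id _ := RigidHypercover.Hom.ext (Category.comp_id _)
  assoc _ _ _ := RigidHypercover.Hom.ext (Category.assoc _ _ _)

/-- The functor taking a rigid hypercover `U` to the scheme `U_{-1}` that it covers. -/
def augmentation : RigidHypercover.{u} Ω ⥤ Scheme.{u} where
  obj V := V.U.obj (op WithInitial.star)
  map f := f.map.app (op WithInitial.star)
  map_id _ := rfl
  map_comp _ _ := rfl

/-- The category `HRR(X)` of rigid hypercovers of a scheme `X`: rigid hypercovers `U` with an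
identification `U_{-1} ≅ X`. -/
structure HRR (X : Scheme.{u}) where
  V : RigidHypercover.{u} Ω
  e : (augmentation Ω).obj V ≅ X

/-- A map in `HRR(X)`: a rigid hypercover map over the identity of `X`. -/
@[ext]
structure HRR.Hom {X : Scheme.{u}} (V W : HRR.{u} Ω X) where
  hom : V.V ⟶ W.V
  w : (augmentation Ω).map hom ≫ W.e.hom = V.e.hom

instance (X : Scheme.{u}) : Category (HRR.{u} Ω X) where
  Hom V W := HRR.Hom Ω V W
  id V := ⟨𝟙 V.V, by simp⟩
  comp f g := ⟨f.hom ≫ g.hom, by rw [Functor.map_comp, Category.assoc, g.w, f.w]⟩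
  id_comp _ := HRR.Hom.ext (Category.id_comp _)
  comp_id _ := HRR.Hom.ext (Category.comp_id _)
  assoc _ _ _ := HRR.Hom.ext (Category.assoc _ _ _)

/-- The category `HRR(X)` of rigid hypercovers of a simplicial scheme `X`: simplicial diagrams
`n ↦ U_{n,•}` of rigid hypercovers and rigid hypercover maps (that is, augmented bisimplicial
schemes with these properties), with an identification `U_{•,-1} ≅ X` of simplicial schemes. -/
structure SimplicialHRR (X : SimplicialObject Scheme.{u}) where
  V : SimplexCategoryᵒᵖ ⥤ RigidHypercover.{u} Ω
  e : V ⋙ augmentation Ω ≅ X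

/-- A map in `HRR(X)` for a simplicial scheme `X`: a map of augmented bisimplicial schemes over `X`
which is a rigid hypercover map `U_{n,•} ⟶ U'_{n,•}` for each `n`. -/
@[ext]
structure SimplicialHRR.Hom {X : SimplicialObject Scheme.{u}} (V W : SimplicialHRR.{u} Ω X) where
  hom : V.V ⟶ W.V
  w : Functor.whiskerRight hom (augmentation Ω) ≫ W.e.hom = V.e.hom

instance (X : SimplicialObject Scheme.{u}) : Category (SimplicialHRR.{u} Ω X) where
  Hom V W := SimplicialHRR.Hom Ω V W
  id V := ⟨𝟙 V.V, by ext; simp⟩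
  comp f g := ⟨f.hom ≫ g.hom, by rw [Functor.whiskerRight_comp, Category.assoc, g.w, f.w]⟩
  id_comp _ := SimplicialHRR.Hom.ext (Category.id_comp _)
  comp_id _ := SimplicialHRR.Hom.ext (Category.comp_id _)
  assoc _ _ _ := SimplicialHRR.Hom.ext (Category.assoc _ _ _)

/-- The forgetful functor `HRR(X) ⥤ HRR(X_m)`, `U ↦ U_{m,•}`. -/
def evalHRR (X : SimplicialObject Scheme.{u}) (m : ℕ) :
    SimplicialHRR.{u} Ω X ⥤ HRR.{u} Ω (X.obj (op (SimplexCategory.mk m))) where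
  obj V := ⟨V.V.obj (op (SimplexCategory.mk m)), V.e.app (op (SimplexCategory.mk m))⟩
  map f := ⟨f.hom.app (op (SimplexCategory.mk m)),
    NatTrans.congr_app f.w (op (SimplexCategory.mk m))⟩
  map_id _ := rfl
  map_comp _ _ := rfl

/-- The forgetful functor `HRR(X) ⥤ HRR(X_0) × ⋯ × HRR(X_n)`. -/
def forgetHRR (X : SimplicialObject Scheme.{u}) (n : ℕ) :
    SimplicialHRR.{u} Ω X ⥤
      ((m : Fin (n + 1)) → HRR.{u} Ω (X.obj (op (SimplexCategory.mk (m : ℕ))))) :=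
  Functor.pi' fun m => evalHRR Ω X m

end RigidHyper

/-! Rigid hypercover maps deserve their name. Two maps from a connected scheme into an étale
separated one that agree over the base and at one geometric point are equal (`eq_of_geomPt`), so by
induction on degrees a rigid hypercover map is determined by its part in degree -1
(`IsMarked.hom_ext`). Hence the categories HRR are preorders, and cofinality only asks that every
family `d` be dominated by some `U`, and that any two rigid hypercovers of the simplicial scheme
have a common refinement.

Both follow from `exists_simplicialHRR`. Suppose every `X_k` maps to finitely many schemes with
given rigid hypercovers, compatibly with the simplicial operators. Over `X_k` there is a universal
rigid hypercover `W_k` mapping to all of them; universality gives the structure maps between the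
`W_k`, and rigidity makes them functorial. To dominate `d`, use at `[k]` the `d_m` pulled back along
all maps `[m] ⟶ [k]` with `m ≤ n`; to refine two objects, use the pair.

For `W_k` (`exists_universal_rigidHypercover`), start from the fibre product of the pulled back
hypercovers. Each geometric point of a coskeleton still has exactly one marked lift, but the pieces
need not be connected with one marked point each (`IsMarked` without `Free`). This is repaired one
degree at a time: the term in degree `n` is replaced by the coproduct, over its marked points, of
their connected components, which are open by local Noetherianity. In degree `k` this forces a fibre
product over the nondegenerate maps `[n] ⟶ [k]` (`Attachment`); along degenerate maps the lift is
canonical, because lower degrees are already free. Degrees below `n` do not change up to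
isomorphism, so the tower has a degreewise eventually constant limit (`IsMarked.exists_free`). -/

namespace RigidHyper

/-! ### Étale separated morphisms -/

/-- The class of étale separated morphisms of schemes. -/
def EtSep : MorphismProperty Scheme.{u} := @Etale ⊓ @IsSeparated

instance : EtSep.{u}.IsMultiplicative where
  id_mem _ := ⟨inferInstance, inferInstance⟩
  comp_mem f g := by
    rintro ⟨_, _⟩ ⟨_, _⟩
    exact ⟨inferInstance, inferInstance⟩

instance : EtSep.{u}.IsStableUnderBaseChange where
  of_isPullback h := fun ⟨h1, h2⟩ =>
    ⟨MorphismProperty.of_isPullback h h1, MorphismProperty.of_isPullback h h2⟩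

instance : EtSep.{u}.HasOfPostcompProperty EtSep.{u} where
  of_postcomp f g hg hfg := by
    obtain ⟨h1, h2⟩ := hg
    obtain ⟨h3, h4⟩ := hfg
    exact ⟨Etale.of_comp f g, IsSeparated.of_comp f g⟩

lemma EtSep.of_isOpenImmersion {X Y : Scheme.{u}} (f : X ⟶ Y) [IsOpenImmersion f] : EtSep f :=
  ⟨inferInstance, inferInstance⟩

/-- The limit of a finite diagram with a terminal vertex whose maps to that vertex are étale and
separated is étale and separated over it. -/
lemma EtSep.of_isLimit {J : Type} [SmallCategory J] [FinCategory J] {F : J ⥤ Scheme.{u}}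
    {t : J} (ht : IsTerminal t) (h : ∀ j, EtSep (F.map (ht.from j)))
    {c : Cone F} (hc : IsLimit c) (j : J) : EtSep (c.π.app j) := by
  suffices EtSep (c.π.app t) from
    MorphismProperty.of_postcomp EtSep _ _ (h j) (by rwa [c.w])
  have : IsConnected J := isConnected_of_isTerminal _ ht
  -- Étale separated schemes over the terminal vertex have finite limits, and forgetting down to
  -- schemes preserves connected ones. So the limit of `F` is the limit of `G`, whose structure map
  -- is étale and separated by construction.
  let G : J ⥤ EtSep.Over ⊤ (F.obj t) :=
    { obj j := MorphismProperty.Over.mk _ (F.map (ht.from j)) (h j)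
      map f := MorphismProperty.Over.homMk (F.map f) 
        ((F.map_comp _ _).symm.trans (congrArg F.map (ht.hom_ext _ _)))
      map_id j := by ext; exact F.map_id j
      map_comp f g := by ext; exact F.map_comp f g }
  let H : EtSep.Over ⊤ (F.obj t) ⥤ Scheme.{u} :=
    MorphismProperty.Over.forget EtSep ⊤ (F.obj t) ⋙ CategoryTheory.Over.forget (F.obj t)
  have : PreservesLimit G H := inferInstance
  let e : G ⋙ H ≅ F := NatIso.ofComponents (fun j => Iso.refl _) fun f =>
    (Category.comp_id _).trans (Category.id_comp (F.map f)).symm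
  have hl : IsLimit ((Cone.postcompose e.hom).obj (H.mapCone (limit.cone G))) :=
    (IsLimit.postcomposeHomEquiv e _).symm (isLimitOfPreserves H (limit.isLimit G))
  have hw : (hc.conePointUniqueUpToIso hl).hom ≫ H.map (limit.π G t) = c.π.app t :=
    (congrArg (_ ≫ ·) (Category.comp_id _)).symm.trans (hc.conePointUniqueUpToIso_hom_comp hl t)
  rw [← hw]
  refine MorphismProperty.comp_mem _ _ _ (EtSep.of_isOpenImmersion _) ?_
  have h3 : (G.obj t).hom = 𝟙 _ :=
    (congrArg F.map (ht.hom_ext (ht.from t) (𝟙 t))).trans (F.map_id t)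
  have h2 : H.map (limit.π G t) ≫ (G.obj t).hom = (limit G).hom :=
    CategoryTheory.Over.w ((MorphismProperty.Over.forget EtSep ⊤ (F.obj t)).map (limit.π G t))
  rw [h3] at h2
  have h4 : H.map (limit.π G t) = (limit G).hom := (Category.comp_id _).symm.trans h2
  rw [h4]
  exact (limit G).prop

/-! ### Connected components of locally Noetherian schemes -/

/-- The irreducible components through `x` have preconnected union, as they share `x`; the union is
a neighbourhood because the finitely many remaining components form a closed set missing `x`. -/
lemma exists_isPreconnected_mem_nhds_of_noetherianSpace {α : Type*} [TopologicalSpace α]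
    [TopologicalSpace.NoetherianSpace α] (x : α) : ∃ V ∈ nhds x, IsPreconnected V := by
  have hfin := TopologicalSpace.NoetherianSpace.finite_irreducibleComponents (α := α)
  refine ⟨⋃₀ {s ∈ irreducibleComponents α | x ∈ s}, ?_,
    isPreconnected_sUnion x _ (fun s hs => hs.2) fun s hs => hs.1.1.isPreirreducible.isPreconnected⟩
  have hc : IsClosed (⋃₀ {s ∈ irreducibleComponents α | x ∉ s}) := by
    rw [Set.sUnion_eq_biUnion]
    exact Set.Finite.isClosed_biUnion (Set.Finite.subset hfin (Set.sep_subset _ _)) fun s hs =>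
      isClosed_of_mem_irreducibleComponents s hs.1
  refine Filter.mem_of_superset (hc.isOpen_compl.mem_nhds fun ⟨s, hs, hx⟩ => hs.2 hx) fun y hy => ?_
  by_contra hy'
  refine hy ⟨irreducibleComponent y, ⟨irreducibleComponent_mem_irreducibleComponents y, fun hx => ?_⟩,
    mem_irreducibleComponent⟩
  exact hy' ⟨irreducibleComponent y, ⟨irreducibleComponent_mem_irreducibleComponents y, hx⟩,
    mem_irreducibleComponent⟩

/-- This is what local Noetherianity is for: connected components become open, hence open
subschemes. -/
instance (X : Scheme.{u}) [IsLocallyNoetherian X] : LocallyConnectedSpace X := by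
  rw [locallyConnectedSpace_iff_connected_subsets]
  intro x U hU
  obtain ⟨_, ⟨W, hW, rfl⟩, hxW, hWU⟩ :=
    X.isBasis_affineOpens.mem_nhds_iff.mp hU
  have : IsNoetherianRing Γ(X, W) := IsLocallyNoetherian.component_noetherian ⟨W, hW⟩
  have : TopologicalSpace.NoetherianSpace (W : Set X) := noetherianSpace_of_isAffineOpen W hW
  obtain ⟨V, hV, hV'⟩ := exists_isPreconnected_mem_nhds_of_noetherianSpace (⟨x, hxW⟩ : (W : Set X))
  refine ⟨Subtype.val '' V, W.isOpen.isOpenEmbedding_subtypeVal.image_mem_nhds.mpr hV,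
    hV'.image _ continuous_subtype_val.continuousOn, ?_⟩
  rintro _ ⟨y, _, rfl⟩
  exact hWU y.2

/-! ### Rigidity of étale separated morphisms -/

variable {I : Type u} {Ω : I → Type u} [∀ i, Field (Ω i)]

/-- The point of the underlying space of a geometric point. -/
noncomputable def GeomPt.point {X : Scheme.{u}} (x : GeomPt Ω X) : X :=
  x.hom (default : Spec (CommRingCat.of (Ω x.i)))

lemma GeomPt.point_map {X Y : Scheme.{u}} (f : X ⟶ Y) (x : GeomPt Ω X) :
    (x.map f).point = f x.point :=
  Scheme.Hom.comp_apply _ _ _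

lemma GeomPt.map_injective {X Y : Scheme.{u}} (f : X ⟶ Y) [Mono f] :
    Function.Injective (GeomPt.map (Ω := Ω) f) := by
  rintro ⟨i, x⟩ ⟨j, y⟩ h
  obtain rfl : i = j := congrArg GeomPt.i h
  simp only [GeomPt.map, GeomPt.mk.injEq, heq_eq_eq, true_and, cancel_mono] at h
  rw [h]

/-- The equalizer of `g` and `g'` is the pullback of the diagonal of `f`. It is open since `f` is
étale, closed since `f` is separated, and nonempty since it contains `t`; hence it is all of `T`. -/
lemma eq_of_geomPt {T A D : Scheme.{u}} [ConnectedSpace T] (f : A ⟶ D) (hf : EtSep f)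
    (g g' : T ⟶ A) (h : g ≫ f = g' ≫ f) (t : GeomPt Ω T) (ht : t.map g = t.map g') : g = g' := by
  obtain ⟨_, _⟩ := hf
  let d : T ⟶ pullback f f := pullback.lift g g' h
  have hd1 : d ≫ pullback.fst f f = g := pullback.lift_fst _ _ _
  have hd2 : d ≫ pullback.snd f f = g' := pullback.lift_snd _ _ _
  let p : pullback d (pullback.diagonal f) ⟶ T := pullback.fst _ _
  have : IsOpenImmersion p := by
    dsimp only [p]; infer_instance
  have : IsClosedImmersion p := by
    dsimp only [p]; infer_instance
  have hr : Set.range p = Set.univ := by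
    refine IsClopen.eq_univ ⟨p.isClosedEmbedding.isClosed_range, p.isOpenEmbedding.isOpen_range⟩ ?_
    have e : t.hom ≫ g = t.hom ≫ g' := by simpa [GeomPt.map] using ht
    let q : Spec (CommRingCat.of (Ω t.i)) ⟶ pullback d (pullback.diagonal f) :=
      pullback.lift t.hom (t.hom ≫ g) (by
        apply pullback.hom_ext
        · simp [hd1]
        · simp [hd2, e])
    exact ⟨_, q default, rfl⟩
  have : Surjective p := ⟨Set.range_eq_univ.mp hr⟩
  have : IsIso p := isIso_iff_isOpenImmersion_and_surjective p |>.mpr ⟨inferInstance, inferInstance⟩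
  have hc := pullback.condition (f := d) (g := pullback.diagonal f)
  have e1 : p ≫ g = pullback.snd _ _ := by
    rw [← hd1, ← Category.assoc, hc, Category.assoc, pullback.diagonal_fst, Category.comp_id]
  have e2 : p ≫ g' = pullback.snd _ _ := by
    rw [← hd2, ← Category.assoc, hc, Category.assoc, pullback.diagonal_snd, Category.comp_id]
  rw [← cancel_epi p, e1, e2]
/-! ### Schemes freely generated by geometric points -/

/-- A decomposition of a scheme `A` into connected open and closed pieces, each containing exactly
one distinguished geometric point. -/
structure PointedDecomp {K : Type u} (A : Scheme.{u}) (s : K → GeomPt Ω A) where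
  component : K → Scheme.{u}
  ι (k : K) : component k ⟶ A
  isCoproduct : Nonempty (IsColimit (Cofan.mk A ι))
  connected (k : K) : ConnectedSpace (component k)
  base (k : K) : GeomPt Ω (component k)
  base_map (k : K) : (base k).map (ι k) = s k

/-- `A` is the disjoint union of connected schemes, each marked by one of the geometric points in
`S`. -/
def Free (A : Scheme.{u}) (S : Set (GeomPt Ω A)) : Prop :=
  Nonempty (PointedDecomp A (Subtype.val : S → GeomPt Ω A))

noncomputable def PointedDecomp.reindex {K K' : Type u} {A : Scheme.{u}} {s : K → GeomPt Ω A}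
    (c : PointedDecomp A s) (e : K' ≃ K) : PointedDecomp A (s ∘ e) where
  component k := c.component (e k)
  ι k := c.ι (e k)
  isCoproduct := by
    obtain ⟨h⟩ := c.isCoproduct
    exact ⟨Cofan.isColimitEquivOfEquiv e _ h⟩
  connected k := c.connected (e k)
  base k := c.base (e k)
  base_map k := c.base_map (e k)

lemma PointedDecomp.free {K : Type u} {A : Scheme.{u}} {s : K → GeomPt Ω A}
    (c : PointedDecomp A s) (hs : Function.Injective s) : Free A (Set.range s) := by
  have h : s ∘ (Equiv.ofInjective s hs).symm = Subtype.val := by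
    ext x
    exact congrArg Subtype.val ((Equiv.ofInjective s hs).apply_symm_apply x)
  exact ⟨h ▸ c.reindex (Equiv.ofInjective s hs).symm⟩

lemma exists_iso_sigma {K : Type u} {A : Scheme.{u}} {U : K → Scheme.{u}}
    {ι : ∀ k, U k ⟶ A} (h : IsColimit (Cofan.mk A ι)) :
    ∃ e : (∐ U) ≅ A, ∀ k, Sigma.ι U k ≫ e.hom = ι k :=
  ⟨(coproductIsCoproduct U).coconePointUniqueUpToIso h, fun k =>
    (coproductIsCoproduct U).comp_coconePointUniqueUpToIso_hom h ⟨k⟩⟩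

lemma isOpenImmersion_of_isColimit_cofan {K : Type u} {A : Scheme.{u}} {U : K → Scheme.{u}}
    {ι : ∀ k, U k ⟶ A} (h : IsColimit (Cofan.mk A ι)) (k : K) : IsOpenImmersion (ι k) := by
  obtain ⟨e, he⟩ := exists_iso_sigma h
  rw [← he]
  infer_instance

lemma isClosed_range_of_isColimit_cofan {K : Type u} {A : Scheme.{u}} {U : K → Scheme.{u}}
    {ι : ∀ k, U k ⟶ A} (h : IsColimit (Cofan.mk A ι)) (k : K) : IsClosed (Set.range (ι k)) := by
  obtain ⟨e, he⟩ := exists_iso_sigma h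
  have hs : (Set.range (Sigma.ι U k))ᶜ = ⋃ l : {l // l ≠ k}, Set.range (Sigma.ι U l) := by
    ext x
    constructor
    · intro hx
      obtain ⟨l, y, rfl⟩ := (sigmaOpenCover U).exists_eq x
      by_cases hl : l = k
      · subst hl
        exact absurd ⟨y, rfl⟩ hx
      · exact Set.mem_iUnion.mpr ⟨⟨l, hl⟩, y, rfl⟩
    · rintro hx ⟨y, rfl⟩
      obtain ⟨⟨l, hl⟩, z, hz⟩ := Set.mem_iUnion.mp hx
      exact hl (congrArg Sigma.fst ((sigmaι_eq_iff _ _ _ _ _).mp hz))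
  have hc : IsClosed (Set.range (Sigma.ι U k)) := by
    rw [← isOpen_compl_iff, hs]
    exact isOpen_iUnion fun l => (Sigma.ι U l.1).isOpenEmbedding.isOpen_range
  have hr : Set.range (ι k) = e.hom '' Set.range (Sigma.ι U k) := by
    rw [← Set.range_comp, ← he]
    congr 1
  rw [hr]
  exact e.hom.homeomorph.isClosedMap _ hc

/-- A map from a connected scheme to a coproduct factors through the piece that contains the image
of some geometric point. -/
lemma exists_lift_of_isColimit_cofan {K : Type u} {A : Scheme.{u}} {U : K → Scheme.{u}}
    {ι : ∀ k, U k ⟶ A} (h : IsColimit (Cofan.mk A ι)) {T : Scheme.{u}} [ConnectedSpace T]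
    (g : T ⟶ A) (t : GeomPt Ω T) (k : K) (x : GeomPt Ω (U k)) (hx : x.map (ι k) = t.map g) :
    ∃ l : T ⟶ U k, l ≫ ι k = g ∧ t.map l = x := by
  have := isOpenImmersion_of_isColimit_cofan h k
  have hr : g ⁻¹' Set.range (ι k) = Set.univ := by
    refine IsClopen.eq_univ ⟨(isClosed_range_of_isColimit_cofan h k).preimage g.continuous,
      (ι k).isOpenEmbedding.isOpen_range.preimage g.continuous⟩ ⟨t.point, x.point, ?_⟩
    rw [← GeomPt.point_map, ← GeomPt.point_map, hx]
  have hr' : Set.range g ⊆ Set.range (ι k) := Set.range_subset_iff.mpr fun y =>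
    (hr.symm ▸ Set.mem_univ y : y ∈ g ⁻¹' Set.range (ι k))
  refine ⟨IsOpenImmersion.lift (ι k) g hr', IsOpenImmersion.lift_fac _ _ _, ?_⟩
  apply GeomPt.map_injective (ι k)
  rw [← GeomPt.map_comp, IsOpenImmersion.lift_fac, hx]

/-- This map is the diagonal of `f` restricted to the open piece `U k ×_D U l` of the fibre square.
For `k = l` it is the diagonal of a separated map; for `k ≠ l` its source is empty. -/
lemma isClosedImmersion_map_sigma {K : Type u} {D : Scheme.{u}} {U : K → Scheme.{u}}
    {f : (∐ U) ⟶ D} (hf : ∀ k, EtSep (Sigma.ι U k ≫ f)) (k l : K) :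
    IsClosedImmersion (pullback.map (Sigma.ι U k) (Sigma.ι U l) (Sigma.ι U k ≫ f)
      (Sigma.ι U l ≫ f) (𝟙 _) (𝟙 _) f (Category.id_comp _).symm (Category.id_comp _).symm) := by
  by_cases h : k = l
  · subst h
    let d : U k ⟶ pullback (Sigma.ι U k) (Sigma.ι U k) := pullback.diagonal (Sigma.ι U k)
    have hd : d ≫ pullback.map (Sigma.ι U k) (Sigma.ι U k)
        (Sigma.ι U k ≫ f) (Sigma.ι U k ≫ f) (𝟙 _) (𝟙 _) f (Category.id_comp _).symm
        (Category.id_comp _).symm = pullback.diagonal (Sigma.ι U k ≫ f) := by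
      have h1 : d ≫ pullback.fst _ _ = 𝟙 _ := pullback.diagonal_fst _
      have h2 : d ≫ pullback.snd _ _ = 𝟙 _ := pullback.diagonal_snd _
      apply pullback.hom_ext
      · rw [Category.assoc, pullback.map, pullback.lift_fst, reassoc_of% h1, pullback.diagonal_fst]
      · rw [Category.assoc, pullback.map, pullback.lift_snd, reassoc_of% h2, pullback.diagonal_snd]
    have : IsIso d := inferInstanceAs (IsIso (pullback.diagonal (Sigma.ι U k)))
    rw [← MorphismProperty.cancel_left_of_respectsIso @IsClosedImmersion d, hd]
    exact (hf k).2.isClosedImmersion_diagonal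
  · have := isEmpty_pullback_sigmaι_of_ne U h
    infer_instance

/-- Étaleness is local on the source. Separatedness is not, so the diagonal is tested on the cover
of the fibre square by the products of pieces. -/
lemma EtSep.sigmaDesc {K : Type u} {D : Scheme.{u}} {U : K → Scheme.{u}} {f : (∐ U) ⟶ D}
    (hf : ∀ k, EtSep (Sigma.ι U k ≫ f)) : EtSep f := by
  constructor
  · have h1 : HasRingHomProperty @Etale RingHom.Etale := inferInstance
    have h2 : IsZariskiLocalAtSource @Etale.{u} := HasRingHomProperty.instIsZariskiLocalAtSource
    have : f = Sigma.desc fun k => Sigma.ι U k ≫ f := Sigma.hom_ext _ _ fun k => by simp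
    rw [this]
    exact IsZariskiLocalAtSource.sigmaDesc fun k => (hf k).1
  · refine ⟨(IsZariskiLocalAtTarget.iff_of_openCover (P := @IsClosedImmersion)
      (Scheme.Pullback.openCoverOfLeftRight (sigmaOpenCover U) (sigmaOpenCover U) f f)).mpr ?_⟩
    rintro ⟨k, l⟩
    have sq := pullback_map_diagonal_isPullback (Sigma.ι U k) (Sigma.ι U l) f
    refine (MorphismProperty.cancel_left_of_respectsIso @IsClosedImmersion
      sq.isoPullback.hom _).mp ?_
    exact (congrArg _ sq.isoPullback_hom_snd).mpr (isClosedImmersion_map_sigma hf k l)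

/-- A map from a coproduct that is étale and separated on each piece is étale and separated. -/
lemma EtSep.of_isColimit_cofan {K : Type u} {A D : Scheme.{u}} {U : K → Scheme.{u}}
    {ι : ∀ k, U k ⟶ A} (h : IsColimit (Cofan.mk A ι)) (f : A ⟶ D)
    (hf : ∀ k, EtSep (ι k ≫ f)) : EtSep f := by
  obtain ⟨e, he⟩ := exists_iso_sigma h
  rw [← e.inv_hom_id_assoc f]
  refine MorphismProperty.comp_mem _ _ _ (EtSep.of_isOpenImmersion _) (EtSep.sigmaDesc fun k => ?_)
  rw [reassoc_of% he]
  exact hf k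

/-- Maps from a scheme freely generated by geometric points into an étale separated scheme are
determined by their effect on the generators. -/
lemma Free.hom_ext {T A D : Scheme.{u}} {S : Set (GeomPt Ω T)} (hT : Free T S) (f : A ⟶ D)
    (hf : EtSep f) {g g' : T ⟶ A} (h : g ≫ f = g' ≫ f)
    (hS : ∀ t ∈ S, t.map g = t.map g') : g = g' := by
  obtain ⟨c⟩ := hT
  obtain ⟨hc⟩ := c.isCoproduct
  refine Cofan.IsColimit.hom_ext hc _ _ fun k => ?_
  have := c.connected k
  refine eq_of_geomPt f hf _ _ ?_ (c.base k) ?_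
  · simp [h]
  · rw [GeomPt.map_comp, GeomPt.map_comp]
    exact (c.base_map k).symm ▸ hS _ k.2

/-- The coproduct of the connected components of `A` that contain the geometric points in `S`. -/
lemma exists_free {A : Scheme.{u}} [IsLocallyNoetherian A] (S : Set (GeomPt Ω A)) :
    ∃ (R : Scheme.{u}) (r : R ⟶ A) (S' : Set (GeomPt Ω R)), EtSep r ∧ Free R S' ∧
      Set.BijOn (GeomPt.map r) S' S ∧
      ∀ {T : Scheme.{u}} {S'' : Set (GeomPt Ω T)} (_ : Free T S'') (g : T ⟶ A)
        (_ : Set.MapsTo (GeomPt.map g) S'' S),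
        ∃ l : T ⟶ R, l ≫ r = g ∧ Set.MapsTo (GeomPt.map l) S'' S' := by
  let comp (s : S) : A.Opens := ⟨connectedComponent s.1.point, isOpen_connectedComponent⟩
  have hb (s : S) : ∃ b : GeomPt Ω (comp s).toScheme, b.map (comp s).ι = s.1 := by
    have hr : Set.range s.1.hom ⊆ Set.range (comp s).ι := by
      rw [Scheme.Opens.range_ι]
      refine Set.range_subset_iff.mpr fun y => ?_
      obtain rfl := Subsingleton.elim default y
      exact mem_connectedComponent
    exact ⟨⟨s.1.i, IsOpenImmersion.lift (comp s).ι s.1.hom hr⟩, by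
      rw [GeomPt.map, IsOpenImmersion.lift_fac]⟩
  choose b hb using hb
  -- The coproduct is indexed by `S`, not by components: a component containing several points of
  -- `S` is repeated once for each of them.
  let U (s : S) : Scheme.{u} := (comp s).toScheme
  let r : (∐ U) ⟶ A := Sigma.desc fun s => (comp s).ι
  have hr (s : S) : Sigma.ι U s ≫ r = (comp s).ι := by simp [r]
  let c : PointedDecomp (∐ U) fun s : S => (b s).map (Sigma.ι U s) :=
    { component := U
      ι := Sigma.ι U
      isCoproduct := ⟨coproductIsCoproduct U⟩
      connected s := isConnected_iff_connectedSpace.mp isConnected_connectedComponent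
      base := b
      base_map _ := rfl }
  have hbr (s : S) : ((b s).map (Sigma.ι U s)).map r = s.1 := by
    rw [← GeomPt.map_comp, hr, hb]
  have hinj : Function.Injective fun s : S => (b s).map (Sigma.ι U s) := fun s s' h =>
    Subtype.ext (by rw [← hbr, ← hbr]; exact congrArg _ h)
  refine ⟨∐ U, r, _, EtSep.sigmaDesc fun s => ?_, c.free hinj, ⟨?_, ?_, ?_⟩, ?_⟩
  · rw [hr]
    exact EtSep.of_isOpenImmersion _
  · rintro _ ⟨s, rfl⟩
    exact (hbr s).symm ▸ s.2
  · rintro _ ⟨s, rfl⟩ _ ⟨s', rfl⟩ h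
    simp only [hbr] at h
    rw [Subtype.ext h]
  · intro s hs
    exact ⟨_, ⟨⟨s, hs⟩, rfl⟩, hbr ⟨s, hs⟩⟩
  · rintro T S'' ⟨d⟩ g hg
    obtain ⟨hd⟩ := d.isCoproduct
    let σ (k : S'') : S := ⟨k.1.map g, hg k.2⟩
    have hl (k : S'') : ∃ l : d.component k ⟶ U (σ k), l ≫ (comp (σ k)).ι = d.ι k ≫ g ∧
        (d.base k).map l = b (σ k) := by
      have := d.connected k
      have hk : (d.base k).map (d.ι k ≫ g) = (σ k).1 := by
        rw [GeomPt.map_comp, d.base_map]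
      -- The image of a connected piece lies in the connected component of the image of its base
      -- point.
      have hrange : Set.range (d.ι k ≫ g) ⊆ Set.range (comp (σ k)).ι := by
        rw [Scheme.Opens.range_ι]
        refine (isPreconnected_range (d.ι k ≫ g).continuous).subset_connectedComponent ?_
        exact ⟨(d.base k).point, by rw [← GeomPt.point_map, hk]⟩
      refine ⟨IsOpenImmersion.lift (comp (σ k)).ι (d.ι k ≫ g) hrange,
        IsOpenImmersion.lift_fac _ _ _, GeomPt.map_injective (comp (σ k)).ι ?_⟩
      rw [← GeomPt.map_comp, IsOpenImmersion.lift_fac, hb, hk]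
    choose l hl hl' using hl
    let m : T ⟶ ∐ U := Cofan.IsColimit.desc hd fun k => l k ≫ Sigma.ι U (σ k)
    have hm (k : S'') : d.ι k ≫ m = l k ≫ Sigma.ι U (σ k) := Cofan.IsColimit.fac hd _ k
    refine ⟨m, Cofan.IsColimit.hom_ext hd _ _ fun k => ?_, fun t ht => ⟨σ ⟨t, ht⟩, ?_⟩⟩
    · rw [cofan_mk_inj, reassoc_of% hm, hr, hl]
    · have := d.base_map ⟨t, ht⟩
      refine Eq.trans ?_ (congrArg _ this)
      rw [← GeomPt.map_comp, hm, GeomPt.map_comp, hl']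

/-! ### Projections of coskeleta -/

/-- The map `[-1] ⟶ k`. -/
def fromStar (k : AugmentedSimplexCategory) : WithInitial.star ⟶ k :=
  WithInitial.starInitial.to k

lemma fromStar_comp {k l : AugmentedSimplexCategory} (f : k ⟶ l) :
    fromStar k ≫ f = fromStar l :=
  WithInitial.starInitial.hom_ext _ _

lemma star_hom_eq {k : AugmentedSimplexCategory} (f : WithInitial.star ⟶ k) : f = fromStar k :=
  WithInitial.starInitial.hom_ext _ _

/-- The map `[n] ⟶ [m]` of the augmented simplex category given by a map of the simplex category. -/
def ordMap {n m : ℕ} (f : SimplexCategory.mk n ⟶ SimplexCategory.mk m) : ord n ⟶ ord m :=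
  WithInitial.incl.map f

lemma ordMap_id (n : ℕ) : ordMap (𝟙 (SimplexCategory.mk n)) = 𝟙 (ord n) := rfl

lemma ordMap_surjective {n m : ℕ} (f : ord n ⟶ ord m) :
    ∃ g : SimplexCategory.mk n ⟶ SimplexCategory.mk m, ordMap g = f :=
  ⟨WithInitial.incl.preimage f, WithInitial.incl.map_preimage f⟩

lemma below_star (n : ℕ) : below n WithInitial.star := trivial

lemma below_ord {n k : ℕ} : below n (ord k) ↔ k < n := Iff.rfl

section Cosk

variable (A : AugSimplicialScheme.{u})

/-- The component of the limit `(cosk_{n-1} A)_n` at a map `γ : l ⟶ [n]` with `l < n`. -/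
noncomputable def coskπ {n : ℕ} {l : AugmentedSimplexCategory} (hl : below n l) (γ : l ⟶ ord n) :
    cosk A n ⟶ A.obj (op l) :=
  limit.π (coskDiagram A n)
    (StructuredArrow.mk (Y := op (⟨l, hl⟩ : (below n).FullSubcategory)) γ.op)

variable {A}

lemma toCosk_coskπ {n : ℕ} {l : AugmentedSimplexCategory} (hl : below n l) (γ : l ⟶ ord n) :
    toCosk A n ≫ coskπ A hl γ = A.map γ.op :=
  limit.lift_π _ _

lemma coskMap_coskπ {A' : AugSimplicialScheme.{u}} (g : A ⟶ A') {n : ℕ}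
    {l : AugmentedSimplexCategory} (hl : below n l) (γ : l ⟶ ord n) :
    coskMap g n ≫ coskπ A' hl γ = coskπ A hl γ ≫ g.app (op l) :=
  limMap_π _ _

lemma coskπ_map {n : ℕ} {l k : AugmentedSimplexCategory} (hl : below n l) (hk : below n k)
    (γ : l ⟶ ord n) (δ : k ⟶ l) :
    coskπ A hl γ ≫ A.map δ.op = coskπ A hk (δ ≫ γ) := by
  let j : StructuredArrow (op (ord n)) (belowIncl n) :=
    StructuredArrow.mk (Y := op (⟨l, hl⟩ : (below n).FullSubcategory)) γ.op
  let j' : StructuredArrow (op (ord n)) (belowIncl n) :=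
    StructuredArrow.mk (Y := op (⟨k, hk⟩ : (below n).FullSubcategory)) (δ ≫ γ).op
  let f : j ⟶ j' := StructuredArrow.homMk (Quiver.Hom.op (ObjectProperty.homMk δ)) rfl
  exact limit.w (coskDiagram A n) f

lemma cosk_hom_ext {T : Scheme.{u}} {n : ℕ} {f g : T ⟶ cosk A n}
    (h : ∀ (l : AugmentedSimplexCategory) (hl : below n l) (γ : l ⟶ ord n),
      f ≫ coskπ A hl γ = g ≫ coskπ A hl γ) : f = g :=
  limit.hom_ext fun j => h j.right.unop.obj j.right.unop.property j.hom.unop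

lemma toCosk_coskMap {A' : AugSimplicialScheme.{u}} (g : A ⟶ A') (n : ℕ) :
    toCosk A n ≫ coskMap g n = g.app (op (ord n)) ≫ toCosk A' n := by
  refine cosk_hom_ext fun l hl γ => ?_
  rw [Category.assoc, Category.assoc, coskMap_coskπ, toCosk_coskπ, reassoc_of% toCosk_coskπ (A := A),
    g.naturality]

/-- If the terms of `A` in degrees `< n` are étale and separated over `A_{-1}`, so is
`(cosk_{n-1} A)_n`. -/
lemma etSep_coskπ_star {n : ℕ}
    (h : ∀ k, below n k → EtSep (A.map (fromStar k).op)) :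
    EtSep (coskπ A (below_star n) (fromStar (ord n))) := by
  -- Since `[-1]` is initial, it gives a terminal vertex of the diagram defining the coskeleton.
  let t : StructuredArrow (op (ord n)) (belowIncl n) := StructuredArrow.mk
    (Y := op (⟨.star, below_star n⟩ : (below n).FullSubcategory)) (fromStar (ord n)).op
  let ht : IsTerminal t := IsTerminal.ofUniqueHom
    (fun j => StructuredArrow.homMk (Quiver.Hom.op (ObjectProperty.homMk
      (fromStar j.right.unop.obj))) (Quiver.Hom.unop_inj (star_hom_eq _)))
    (fun j m => by
      apply StructuredArrow.ext
      apply Quiver.Hom.unop_inj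
      exact ObjectProperty.hom_ext _ (star_hom_eq _))
  exact EtSep.of_isLimit ht (fun j => h _ j.right.unop.property) (limit.isLimit _) t

lemma etSep_toCosk (h : ∀ k, EtSep (A.map (fromStar k).op)) (n : ℕ) : EtSep (toCosk A n) :=
  MorphismProperty.of_postcomp EtSep _ _ (etSep_coskπ_star fun k _ => h k)
    (by rw [toCosk_coskπ]; exact h _)

end Cosk

/-! ### Augmented simplicial schemes with distinguished geometric points -/

variable (Ω) in
/-- A choice of distinguished geometric points in the terms of an augmented simplicial scheme. -/
abbrev Marking (A : AugSimplicialScheme.{u}) := ∀ n : ℕ, Set (GeomPt Ω (A.obj (op (ord n))))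

/-- The marking `B` makes `A` look like a rigid hypercover, except for connectedness: all terms are
étale and separated over `A_{-1}`, every geometric point of `(cosk_{n-1} A)_n` is the image of
exactly one marked point, and degeneracies preserve marked points. -/
structure IsMarked (A : AugSimplicialScheme.{u}) (B : Marking Ω A) : Prop where
  etSep (k : AugmentedSimplexCategory) : EtSep (A.map (fromStar k).op)
  bijOn (n : ℕ) : Set.BijOn (GeomPt.map (toCosk A n)) (B n) Set.univ
  degeneracy (n : ℕ) (i : Fin (n + 1)) :
    Set.MapsTo (GeomPt.map (A.map (ordMap (SimplexCategory.σ i)).op))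
      (B n) (B (n + 1))

/-- The map `g` preserves marked points. -/
def PreservesMarking {A A' : AugSimplicialScheme.{u}} (B : Marking Ω A) (B' : Marking Ω A')
    (g : A ⟶ A') : Prop :=
  ∀ n, Set.MapsTo (GeomPt.map (g.app (op (ord n)))) (B n) (B' n)

lemma PreservesMarking.comp {A A' A'' : AugSimplicialScheme.{u}} {B : Marking Ω A}
    {B' : Marking Ω A'} {B'' : Marking Ω A''} {g : A ⟶ A'} {g' : A' ⟶ A''}
    (h : PreservesMarking B B' g) (h' : PreservesMarking B' B'' g') :
    PreservesMarking B B'' (g ≫ g') := fun n x hx => by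
  rw [NatTrans.comp_app, GeomPt.map_comp]
  exact h' n (h n hx)

lemma IsMarked.eq_of_map_eq {A : AugSimplicialScheme.{u}} {B : Marking Ω A} (hA : IsMarked A B)
    {n : ℕ} {x y : GeomPt Ω (A.obj (op (ord n)))} (hx : x ∈ B n) (hy : y ∈ B n)
    (h : x.map (toCosk A n) = y.map (toCosk A n)) : x = y :=
  (hA.bijOn n).injOn hx hy h

/-- Marked maps out of an augmented simplicial scheme that is free on its marked points are
determined by their value in degree `-1`. -/
lemma IsMarked.hom_ext {T A : AugSimplicialScheme.{u}} {BT : Marking Ω T} {B : Marking Ω A}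
    (hA : IsMarked A B) (hT : ∀ n, Free (T.obj (op (ord n))) (BT n)) {g g' : T ⟶ A}
    (hg : PreservesMarking BT B g) (hg' : PreservesMarking BT B g')
    (h : g.app (op WithInitial.star) = g'.app (op WithInitial.star)) : g = g' := by
  have key (n : ℕ) : g.app (op (ord n)) = g'.app (op (ord n)) := by
    induction n using Nat.strong_induction_on with
    | _ n ih =>
      have hc : coskMap g n = coskMap g' n := by
        refine cosk_hom_ext fun l hl γ => ?_
        rw [coskMap_coskπ, coskMap_coskπ]
        cases l with
        | star => rw [h]
        | of l => exact congrArg _ (ih l.len hl)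
      have hw : g.app (op (ord n)) ≫ toCosk A n = g'.app (op (ord n)) ≫ toCosk A n := by
        rw [← toCosk_coskMap, ← toCosk_coskMap, hc]
      -- Both maps agree on the coskeleton by induction, and a marked point of `A` is determined by
      -- its image there. So they agree on the marked points, which generate `T` in degree `n`.
      refine (hT n).hom_ext _ (etSep_toCosk hA.etSep n) hw fun t ht => ?_
      refine hA.eq_of_map_eq (hg n ht) (hg' n ht) ?_
      rw [← GeomPt.map_comp, ← GeomPt.map_comp, hw]
  ext ⟨k⟩ : 2
  cases k with
  | star => exact h
  | of k => exact key k.len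

/-! ### Rigid hypercovers as marked augmented simplicial schemes -/

lemma RigidCover.pt_map {U X : Scheme.{u}} {f : U ⟶ X} (c : RigidCover Ω f) (x : GeomPt Ω X) :
    (c.pt x).map f = x := by
  rw [RigidCover.pt, ← GeomPt.map_comp, c.base_map]

lemma RigidCover.pt_injective {U X : Scheme.{u}} {f : U ⟶ X} (c : RigidCover Ω f) :
    Function.Injective c.pt := fun x y h => by
  rw [← c.pt_map x, h, c.pt_map]

lemma RigidCover.etSep {U X : Scheme.{u}} {f : U ⟶ X} (c : RigidCover Ω f) : EtSep f := by
  obtain ⟨h⟩ := c.isCoproduct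
  exact EtSep.of_isColimit_cofan h f fun x => ⟨c.etale x, c.separated x⟩

/-- The basepoints of a rigid hypercover. -/
noncomputable def RigidHypercover.marking (V : RigidHypercover.{u} Ω) : Marking Ω V.U := fun n =>
  Set.range (V.cover n).pt

lemma RigidHypercover.free (V : RigidHypercover.{u} Ω) (n : ℕ) :
    Free (V.U.obj (op (ord n))) (V.marking n) := by
  let c := V.cover n
  let d : PointedDecomp (V.U.obj (op (ord n))) c.pt :=
    { component := c.component
      ι := c.ι
      isCoproduct := c.isCoproduct
      connected := c.connected
      base := c.base
      base_map _ := rfl }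
  exact d.free c.pt_injective

lemma RigidHypercover.isMarked (V : RigidHypercover.{u} Ω) : IsMarked V.U V.marking where
  etSep k := by
    -- The map to degree -1 factors through the coskeleton, which is étale and separated over degree
    -- -1 by the lower degrees.
    have key (n : ℕ) : EtSep (V.U.map (fromStar (ord n)).op) := by
      induction n using Nat.strong_induction_on with
      | _ n ih =>
        rw [← toCosk_coskπ (below_star n)]
        refine MorphismProperty.comp_mem _ _ _ (V.cover n).etSep (etSep_coskπ_star fun k hk => ?_)
        cases k with
        | star =>
          rw [← star_hom_eq (𝟙 _), op_id, V.U.map_id]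
          exact MorphismProperty.id_mem _ _
        | of k => exact ih k.len hk
    cases k with
    | star =>
      rw [← star_hom_eq (𝟙 _), op_id, V.U.map_id]
      exact MorphismProperty.id_mem _ _
    | of k => exact key k.len
  bijOn n := by
    refine ⟨fun _ _ => trivial, ?_, fun x _ => ⟨_, ⟨x, rfl⟩, (V.cover n).pt_map x⟩⟩
    rintro _ ⟨x, rfl⟩ _ ⟨y, rfl⟩ h
    rw [(V.cover n).pt_map, (V.cover n).pt_map] at h
    rw [h]
  degeneracy n i := by
    rintro _ ⟨x, rfl⟩
    exact ⟨_, V.degeneracy n i x⟩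

lemma RigidHypercover.Hom.preservesMarking {V W : RigidHypercover.{u} Ω}
    (g : RigidHypercover.Hom Ω V W) : PreservesMarking V.marking W.marking g.map := by
  rintro n _ ⟨x, rfl⟩
  obtain ⟨a, ha, ha'⟩ := (g.rigid n).2 x
  refine ⟨x.map (coskMap g.map n), ?_⟩
  rw [RigidCover.pt, ← ha', ← GeomPt.map_comp, ha, GeomPt.map_comp]
  rfl

/-- A marked map between rigid hypercovers is a rigid hypercover map. -/
def RigidHypercover.homOfPreservesMarking {V W : RigidHypercover.{u} Ω} (g : V.U ⟶ W.U)
    (hg : PreservesMarking V.marking W.marking g) : V ⟶ W where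
  map := g
  rigid n := by
    refine ⟨(toCosk_coskMap g n).symm, fun x => ?_⟩
    obtain ⟨y, hy⟩ := hg n ⟨x, rfl⟩
    have hxy : y = x.map (coskMap g n) := by
      rw [← (W.cover n).pt_map y, hy, ← GeomPt.map_comp, ← toCosk_coskMap, GeomPt.map_comp,
        (V.cover n).pt_map]
    subst hxy
    have := (V.cover n).connected x
    obtain ⟨h⟩ := (W.cover n).isCoproduct
    refine exists_lift_of_isColimit_cofan h _ _ _ _ ?_
    rw [GeomPt.map_comp]
    exact hy

/-- This turns every functoriality or naturality check for rigid hypercovers into one in degree -1.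
-/
lemma RigidHypercover.hom_ext {V W : RigidHypercover.{u} Ω} {f g : V ⟶ W}
    (h : (augmentation Ω).map f = (augmentation Ω).map g) : f = g :=
  RigidHypercover.Hom.ext (W.isMarked.hom_ext V.free f.preservesMarking g.preservesMarking h)

/-- A marked augmented simplicial scheme that is free on its marked points is a rigid
hypercover. -/
lemma IsMarked.exists_rigidHypercover {A : AugSimplicialScheme.{u}} {B : Marking Ω A}
    (hA : IsMarked A B) (hB : ∀ n, Free (A.obj (op (ord n))) (B n)) :
    ∃ V : RigidHypercover.{u} Ω, ∃ h : V.U = A, h ▸ V.marking = B := by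
  -- Marked points correspond bijectively to geometric points of the coskeleton, so the pieces can
  -- be reindexed as a rigid cover demands.
  let e (n : ℕ) : B n ≃ GeomPt Ω (cosk A n) :=
    ((hA.bijOn n).equiv _).trans (Equiv.Set.univ _)
  have he (n : ℕ) (b : B n) : e n b = b.1.map (toCosk A n) := rfl
  have he' (n : ℕ) (x) : ((e n).symm x).1.map (toCosk A n) = x := by
    rw [← he, Equiv.apply_symm_apply]
  let d (n : ℕ) := (hB n).some
  let c (n : ℕ) := (d n).reindex (e n).symm
  let cov (n : ℕ) : RigidCover Ω (toCosk A n) :=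
    { component := (c n).component
      ι := (c n).ι
      isCoproduct := (c n).isCoproduct
      connected := (c n).connected
      etale x := by
        obtain ⟨h⟩ := (c n).isCoproduct
        have := isOpenImmersion_of_isColimit_cofan h x
        have := (etSep_toCosk hA.etSep n).1
        infer_instance
      separated x := by
        obtain ⟨h⟩ := (c n).isCoproduct
        have := isOpenImmersion_of_isColimit_cofan h x
        have := (etSep_toCosk hA.etSep n).2
        infer_instance
      base := (c n).base
      base_map x := by
        rw [GeomPt.map_comp, (c n).base_map]
        exact he' n x }
  have hpt (n : ℕ) (x) : (cov n).pt x = ((e n).symm x).1 := (c n).base_map x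
  let V : RigidHypercover.{u} Ω :=
    { U := A
      cover := cov
      degeneracy n i x := by
        dsimp only
        rw [hpt, hpt]
        exact congrArg Subtype.val ((e (n + 1)).symm_apply_apply
          ⟨_, hA.degeneracy n i ((e n).symm x).2⟩) }
  refine ⟨V, rfl, ?_⟩
  funext n
  ext y
  constructor
  · rintro ⟨x, rfl⟩
    exact (hpt n x).symm ▸ ((e n).symm x).2
  · intro hy
    exact ⟨e n ⟨y, hy⟩, (hpt _ _).trans (by rw [Equiv.symm_apply_apply])⟩

/-! ### Geometric points of limits -/

lemma GeomPt.map_eq_map_iff {X Y Z : Scheme.{u}} {f : X ⟶ Z} {g : Y ⟶ Z} {i : I}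
    {x : Spec (CommRingCat.of (Ω i)) ⟶ X} {y : Spec (CommRingCat.of (Ω i)) ⟶ Y} :
    GeomPt.map f (⟨i, x⟩ : GeomPt Ω X) = GeomPt.map g ⟨i, y⟩ ↔ x ≫ f = y ≫ g := by
  simp [GeomPt.map]

lemma GeomPt.cosk_ext {A : AugSimplicialScheme.{u}} {n : ℕ} {x y : GeomPt Ω (cosk A n)}
    (h : ∀ (l : AugmentedSimplexCategory) (hl : below n l) (γ : l ⟶ ord n),
      x.map (coskπ A hl γ) = y.map (coskπ A hl γ)) : x = y := by
  obtain ⟨i, x⟩ := x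
  obtain ⟨j, y⟩ := y
  -- The index `[-1]` is always available and identifies the two fields; only then do the two points
  -- have a common source.
  obtain rfl : i = j := congrArg GeomPt.i (h _ (below_star n) (fromStar _))
  rw [cosk_hom_ext fun l hl γ => GeomPt.map_eq_map_iff.mp (h l hl γ)]

lemma GeomPt.ext_of_isPullback {P X Y Z : Scheme.{u}} {fst : P ⟶ X} {snd : P ⟶ Y} {f : X ⟶ Z}
    {g : Y ⟶ Z} (h : IsPullback fst snd f g) {x y : GeomPt Ω P} (h1 : x.map fst = y.map fst)
    (h2 : x.map snd = y.map snd) : x = y := by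
  obtain ⟨i, x⟩ := x
  obtain ⟨j, y⟩ := y
  obtain rfl : i = j := congrArg GeomPt.i h1
  rw [h.hom_ext (GeomPt.map_eq_map_iff.mp h1) (GeomPt.map_eq_map_iff.mp h2)]

lemma GeomPt.exists_of_isPullback {P X Y Z : Scheme.{u}} {fst : P ⟶ X} {snd : P ⟶ Y} {f : X ⟶ Z}
    {g : Y ⟶ Z} (h : IsPullback fst snd f g) {x : GeomPt Ω X} {y : GeomPt Ω Y}
    (hxy : x.map f = y.map g) : ∃ p : GeomPt Ω P, p.map fst = x ∧ p.map snd = y := by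
  obtain ⟨i, x⟩ := x
  obtain ⟨j, y⟩ := y
  obtain rfl : i = j := congrArg GeomPt.i hxy
  refine ⟨⟨i, h.lift x y (GeomPt.map_eq_map_iff.mp hxy)⟩, ?_, ?_⟩ <;> simp [GeomPt.map]

/-! ### Constant augmented simplicial schemes -/

/-- The constant augmented simplicial scheme. -/
abbrev constAug (X : Scheme.{u}) : AugSimplicialScheme.{u} := (Functor.const _).obj X

/-- The map to a constant augmented simplicial scheme given by a map in degree `-1`. -/
def toConstAug {A : AugSimplicialScheme.{u}} {X : Scheme.{u}}
    (h : A.obj (op WithInitial.star) ⟶ X) : A ⟶ constAug X where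
  app k := A.map (fromStar k.unop).op ≫ h
  naturality k l f := by
    refine Eq.trans ?_ (Category.comp_id _).symm
    have hf : f ≫ (fromStar l.unop).op = (fromStar k.unop).op :=
      Quiver.Hom.unop_inj (fromStar_comp f.unop)
    rw [← Category.assoc, ← A.map_comp, hf]

lemma toConstAug_star {A : AugSimplicialScheme.{u}} {X : Scheme.{u}}
    (h : A.obj (op WithInitial.star) ⟶ X) : (toConstAug h).app (op WithInitial.star) = h := by
  have : (fromStar WithInitial.star).op = 𝟙 _ := congrArg _ (star_hom_eq (𝟙 _)).symm
  simp only [toConstAug]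
  rw [this, A.map_id, Category.id_comp]

lemma hom_constAug_ext {A : AugSimplicialScheme.{u}} {X : Scheme.{u}} {f g : A ⟶ constAug X}
    (h : f.app (op WithInitial.star) = g.app (op WithInitial.star)) : f = g := by
  ext k : 2
  have hf := f.naturality (fromStar k.unop).op
  have hg := g.naturality (fromStar k.unop).op
  rw [h, hg] at hf
  exact ((Category.comp_id _).symm.trans (hf.symm.trans (Category.comp_id _)))

/-- All projections of the coskeleton of a constant object agree with the one at `[-1]`, so its
geometric points are those of `X`. This is the empty fibre product, starting the induction over
finite families. -/
lemma isMarked_constAug (X : Scheme.{u}) :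
    IsMarked (Ω := Ω) (constAug X) (fun _ => Set.univ) where
  etSep _ := MorphismProperty.id_mem EtSep X
  bijOn n := by
    have hc (l : AugmentedSimplexCategory) (hl : below n l) (γ : l ⟶ ord n) :
        coskπ (constAug X) hl γ = coskπ (constAug X) (below_star n) (fromStar _) := by
      rw [← fromStar_comp γ, ← coskπ_map hl]
      exact (Category.comp_id _).symm
    have hd : toCosk (constAug X) n ≫ coskπ (constAug X) (below_star n) (fromStar _) = 𝟙 X :=
      toCosk_coskπ _ _
    refine ⟨fun _ _ => trivial, fun x _ y _ h => ?_, fun z _ => ?_⟩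
    · rw [← x.map_id, ← y.map_id]
      refine (congrArg (GeomPt.map · x) hd).symm.trans (Eq.trans ?_ (congrArg (GeomPt.map · y) hd))
      exact (GeomPt.map_comp _ _ x).trans ((congrArg _ h).trans (GeomPt.map_comp _ _ y).symm)
    · let y : GeomPt Ω X := z.map (coskπ (constAug X) (below_star n) (fromStar (ord n)))
      refine ⟨y, trivial, ?_⟩
      refine GeomPt.cosk_ext fun l hl γ => ?_
      rw [hc, ← GeomPt.map_comp]
      refine (congrArg (GeomPt.map · _) hd).trans (GeomPt.map_id _)
  degeneracy _ _ _ _ := trivial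

/-! ### Fibre products -/

section Pullback

variable {A V P : AugSimplicialScheme.{u}} {Y : Scheme.{u}} {fst : P ⟶ A} {snd : P ⟶ V}
  {p : A ⟶ constAug Y} {q : V ⟶ constAug Y} {B : Marking Ω A} {C : Marking Ω V}

lemma isPullback_app (h : IsPullback fst snd p q) (k : AugmentedSimplexCategoryᵒᵖ) :
    IsPullback (fst.app k) (snd.app k) (p.app k) (q.app k) :=
  h.map ((evaluation _ _).obj k)

/-- The map to `Y` factors through the coskeleton. This makes marked lifts in two factors of a fibre
product automatically compatible over `Y`. -/
lemma map_toConstAug (p : A ⟶ constAug Y) (n : ℕ) :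
    toCosk A n ≫ coskπ A (below_star n) (fromStar _) ≫ p.app (op WithInitial.star) =
      p.app (op (ord n)) := by
  rw [reassoc_of% toCosk_coskπ (A := A), p.naturality]
  exact Category.comp_id _

/-- A geometric point of the coskeleton of `P` has images in those of `A` and `V`; their unique
marked lifts agree over `Y` and give the unique marked lift in `P`. Invertibility of `q` in degree
-1 ensures that `P` and `A` have the same base. -/
lemma isMarked_of_isPullback (h : IsPullback fst snd p q) (hA : IsMarked A B) (hV : IsMarked V C)
    [hq : IsIso (q.app (op WithInitial.star))] :
    IsMarked P (fun n => {x | x.map (fst.app _) ∈ B n ∧ x.map (snd.app _) ∈ C n}) where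
  etSep k := by
    have hk := isPullback_app h (op k)
    have hs := isPullback_app h (op WithInitial.star)
    have h1 : EtSep (q.app (op k)) := by
      have := q.naturality (fromStar k).op
      have e : q.app (op k) = V.map (fromStar k).op ≫ q.app (op WithInitial.star) := by
        rw [this]; exact (Category.comp_id _).symm
      rw [e]
      exact MorphismProperty.comp_mem _ _ _ (hV.etSep k) (EtSep.of_isOpenImmersion _)
    have h2 : EtSep (fst.app (op k)) := MorphismProperty.of_isPullback hk.flip h1
    have h3 : IsIso (fst.app (op WithInitial.star)) :=
      MorphismProperty.of_isPullback (P := MorphismProperty.isomorphisms _) hs.flip hq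
    refine MorphismProperty.of_postcomp EtSep _ (fst.app (op WithInitial.star))
      (EtSep.of_isOpenImmersion _) ?_
    rw [fst.naturality]
    exact MorphismProperty.comp_mem _ _ _ h2 (hA.etSep k)
  bijOn n := by
    have hk (k : AugmentedSimplexCategory) := isPullback_app h (op k)
    refine ⟨fun _ _ => trivial, ?_, fun z _ => ?_⟩
    · rintro x ⟨hx, hx'⟩ y ⟨hy, hy'⟩ hxy
      refine GeomPt.ext_of_isPullback (hk _) (hA.eq_of_map_eq hx hy ?_)
        (hV.eq_of_map_eq hx' hy' ?_)
      · rw [← GeomPt.map_comp, ← GeomPt.map_comp, ← toCosk_coskMap, GeomPt.map_comp, hxy,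
          ← GeomPt.map_comp]
      · rw [← GeomPt.map_comp, ← GeomPt.map_comp, ← toCosk_coskMap, GeomPt.map_comp, hxy,
          ← GeomPt.map_comp]
    · obtain ⟨a, ha, ha'⟩ := (hA.bijOn n).surjOn (Set.mem_univ (z.map (coskMap fst n)))
      obtain ⟨b, hb, hb'⟩ := (hV.bijOn n).surjOn (Set.mem_univ (z.map (coskMap snd n)))
      have hab : a.map (p.app _) = b.map (q.app _) := by
        rw [← map_toConstAug, ← map_toConstAug, GeomPt.map_comp, ha', ← GeomPt.map_comp,
          GeomPt.map_comp (toCosk V n), hb', ← GeomPt.map_comp, reassoc_of% @coskMap_coskπ,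
          reassoc_of% @coskMap_coskπ, ← NatTrans.comp_app, ← NatTrans.comp_app, h.w]
      obtain ⟨x, hx, hx'⟩ := GeomPt.exists_of_isPullback (hk (ord n)) hab
      refine ⟨x, ⟨?_, ?_⟩, GeomPt.cosk_ext fun l hl γ => ?_⟩
      · exact hx.symm ▸ ha
      · exact hx'.symm ▸ hb
      · rw [← GeomPt.map_comp, toCosk_coskπ]
        refine GeomPt.ext_of_isPullback (hk _) ?_ ?_
        · rw [← GeomPt.map_comp, ← GeomPt.map_comp]
          rw [fst.naturality, ← coskMap_coskπ, GeomPt.map_comp, GeomPt.map_comp, ← ha',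
            hx, ← GeomPt.map_comp (toCosk A n), toCosk_coskπ]
        · rw [← GeomPt.map_comp, ← GeomPt.map_comp]
          rw [snd.naturality, ← coskMap_coskπ, GeomPt.map_comp, GeomPt.map_comp, ← hb',
            hx', ← GeomPt.map_comp (toCosk V n), toCosk_coskπ]
  degeneracy n i := by
    rintro x ⟨hx, hx'⟩
    refine ⟨?_, ?_⟩
    · rw [← GeomPt.map_comp, fst.naturality, GeomPt.map_comp]
      exact hA.degeneracy n i hx
    · rw [← GeomPt.map_comp, snd.naturality, GeomPt.map_comp]
      exact hV.degeneracy n i hx'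

end Pullback

/-- The fibre product over `X` of the pullbacks of finitely many rigid hypercovers along maps out
of `X`, as a marked augmented simplicial scheme. -/
lemma exists_isMarked_finite {X : Scheme.{u}} {J : Type*} (V : J → RigidHypercover.{u} Ω)
    (f : ∀ j, X ⟶ (augmentation Ω).obj (V j)) (s : Finset J) :
    ∃ (A : AugSimplicialScheme.{u}) (B : Marking Ω A) (e : A.obj (op WithInitial.star) ≅ X),
      IsMarked A B ∧
      (∀ j ∈ s, ∃ p : A ⟶ (V j).U, PreservesMarking B (V j).marking p ∧
        p.app (op WithInitial.star) = e.hom ≫ f j) ∧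
      ∀ (T : AugSimplicialScheme.{u}) (BT : Marking Ω T) (h : T.obj (op WithInitial.star) ⟶ X),
        (∀ j ∈ s, ∃ g : T ⟶ (V j).U, PreservesMarking BT (V j).marking g ∧
          g.app (op WithInitial.star) = h ≫ f j) →
        ∃ g : T ⟶ A, PreservesMarking BT B g ∧ g.app (op WithInitial.star) ≫ e.hom = h := by
  classical
  induction s using Finset.induction_on with
  | empty =>
    refine ⟨constAug X, fun _ => Set.univ, Iso.refl _, isMarked_constAug X, by simp, ?_⟩
    intro T BT h _
    exact ⟨toConstAug h, fun _ _ _ => trivial, (Category.comp_id _).trans (toConstAug_star h)⟩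
  | insert j s hj ih =>
    obtain ⟨A, B, e, hA, hp, hu⟩ := ih
    -- The fibre product of `p` and `q` adjoins to `A` the pullback of `V j` along `f j`.
    let p : A ⟶ constAug ((augmentation Ω).obj (V j)) := toConstAug (e.hom ≫ f j)
    let q : (V j).U ⟶ constAug ((augmentation Ω).obj (V j)) := toConstAug (𝟙 _)
    have hq : q.app (op WithInitial.star) = 𝟙 _ := toConstAug_star _
    have hp' : p.app (op WithInitial.star) = e.hom ≫ f j := toConstAug_star _
    have : IsIso (q.app (op WithInitial.star)) := by
      rw [hq]; exact IsIso.id _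
    have sq := IsPullback.of_hasPullback p q
    have sqs := isPullback_app sq (op WithInitial.star)
    have hi : IsIso ((pullback.fst p q).app (op WithInitial.star)) :=
      MorphismProperty.of_isPullback (P := MorphismProperty.isomorphisms _) sqs.flip this
    refine ⟨pullback p q, _, asIso ((pullback.fst p q).app (op WithInitial.star)) ≪≫ e,
      isMarked_of_isPullback sq hA (V j).isMarked, ?_, ?_⟩
    · intro k hk
      obtain rfl | hk := Finset.mem_insert.mp hk
      · refine ⟨pullback.snd p q, fun n x hx => hx.2, ?_⟩
        have := NatTrans.congr_app sq.w (op WithInitial.star)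
        rw [NatTrans.comp_app, NatTrans.comp_app, hq, hp'] at this
        simpa using ((Category.comp_id _).symm.trans this.symm)
      · obtain ⟨g, hg, hg'⟩ := hp k hk
        refine ⟨pullback.fst p q ≫ g, fun n x hx => ?_, ?_⟩
        · rw [NatTrans.comp_app, GeomPt.map_comp]
          exact hg n hx.1
        · rw [NatTrans.comp_app, hg', Iso.trans_hom, asIso_hom]
          exact (Category.assoc _ _ _).symm
    · intro T BT h H
      obtain ⟨g, hg, hg'⟩ := hu T BT h fun k hk => H k (Finset.mem_insert_of_mem hk)
      obtain ⟨v, hv, hv'⟩ := H j (Finset.mem_insert_self _ _)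
      have hw : g ≫ p = v ≫ q := by
        refine hom_constAug_ext ?_
        rw [NatTrans.comp_app, NatTrans.comp_app, hq, hp', reassoc_of% hg', hv']
        exact (Category.comp_id _).symm
      refine ⟨pullback.lift g v hw, fun n x hx => ⟨?_, ?_⟩, ?_⟩
      · rw [← GeomPt.map_comp, ← NatTrans.comp_app, pullback.lift_fst]
        exact hg n hx
      · rw [← GeomPt.map_comp, ← NatTrans.comp_app, pullback.lift_snd]
        exact hv n hx
      · rw [Iso.trans_hom, asIso_hom, ← Category.assoc, ← NatTrans.comp_app, pullback.lift_fst, hg']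

/-! ### Modifying an augmented simplicial scheme in one degree -/

/-- Data for replacing the term of `P` at `a` by a scheme `W` over it: a class of degenerate maps
out of `a`, with lifts to `W` of the corresponding structure maps of `P`. -/
structure Attachment (P : AugSimplicialScheme.{u}) (a : AugmentedSimplexCategory) where
  W : Scheme.{u}
  r : W ⟶ P.obj (op a)
  D {k : AugmentedSimplexCategory} (α : a ⟶ k) : Prop
  lam {k : AugmentedSimplexCategory} (α : a ⟶ k) (h : D α) : P.obj (op k) ⟶ W
  lam_r {k : AugmentedSimplexCategory} (α : a ⟶ k) (h : D α) : lam α h ≫ r = P.map α.op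
  D_comp {k l : AugmentedSimplexCategory} (α : a ⟶ k) (β : k ⟶ l) (h : D α) : D (α ≫ β)
  lam_comp {k l : AugmentedSimplexCategory} (α : a ⟶ k) (β : k ⟶ l) (h : D α) :
    lam (α ≫ β) (D_comp α β h) = P.map β.op ≫ lam α h

namespace Attachment

variable {P : AugSimplicialScheme.{u}} {a : AugmentedSimplexCategory} (t : Attachment P a)

/-- The nondegenerate maps from `a` to `k`. -/
abbrev Index (k : AugmentedSimplexCategory) : Type := {α : a ⟶ k // ¬ t.D α}

noncomputable instance (k : AugmentedSimplexCategory) : Fintype (t.Index k) := Fintype.ofFinite _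

/-- The fibre products over `P_k` of the pullbacks of `W` along all nondegenerate maps. -/
noncomputable abbrev obj (k : AugmentedSimplexCategory) : Scheme.{u} :=
  widePullback (P.obj (op k)) (fun α : t.Index k => pullback (P.map α.1.op) t.r)
    (fun _ => pullback.fst _ _)

noncomputable def baseMap (k : AugmentedSimplexCategory) : t.obj k ⟶ P.obj (op k) :=
  WidePullback.base _

open Classical in
/-- The component of the modified scheme at a map from `a`. -/
noncomputable def comp {k : AugmentedSimplexCategory} (α : a ⟶ k) : t.obj k ⟶ t.W :=
  if h : t.D α then t.baseMap k ≫ t.lam α h else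
    WidePullback.π (fun α : t.Index k => pullback.fst (P.map α.1.op) t.r) ⟨α, h⟩ ≫
      pullback.snd _ _

lemma comp_of_D {k : AugmentedSimplexCategory} (α : a ⟶ k) (h : t.D α) :
    t.comp α = t.baseMap k ≫ t.lam α h := dif_pos h

lemma comp_of_not_D {k : AugmentedSimplexCategory} (α : a ⟶ k) (h : ¬ t.D α) :
    t.comp α = WidePullback.π (fun α : t.Index k => pullback.fst (P.map α.1.op) t.r) ⟨α, h⟩ ≫
      pullback.snd _ _ := dif_neg h

lemma comp_r {k : AugmentedSimplexCategory} (α : a ⟶ k) :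
    t.comp α ≫ t.r = t.baseMap k ≫ P.map α.op := by
  by_cases h : t.D α
  · rw [comp_of_D t α h, Category.assoc, lam_r]
  · rw [comp_of_not_D t α h, Category.assoc, ← pullback.condition]
    exact WidePullback.π_arrow_assoc _ _ _

lemma hom_ext {k : AugmentedSimplexCategory} {T : Scheme.{u}} {f g : T ⟶ t.obj k}
    (hb : f ≫ t.baseMap k = g ≫ t.baseMap k)
    (hc : ∀ α : a ⟶ k, ¬ t.D α → f ≫ t.comp α = g ≫ t.comp α) : f = g := by
  refine WidePullback.hom_ext _ _ _ (fun α => pullback.hom_ext ?_ ?_) hb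
  · rw [Category.assoc, Category.assoc, WidePullback.π_arrow]
    exact hb
  · have := hc α.1 α.2
    rw [comp_of_not_D t α.1 α.2] at this
    rw [Category.assoc, Category.assoc]
    exact this

lemma exists_lift {k : AugmentedSimplexCategory} {T : Scheme.{u}} (x : T ⟶ P.obj (op k))
    (w : ∀ α : a ⟶ k, ¬ t.D α → (T ⟶ t.W))
    (hw : ∀ (α : a ⟶ k) (h : ¬ t.D α), w α h ≫ t.r = x ≫ P.map α.op) :
    ∃ f : T ⟶ t.obj k, f ≫ t.baseMap k = x ∧ ∀ (α : a ⟶ k) (h : ¬ t.D α),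
      f ≫ t.comp α = w α h := by
  refine ⟨WidePullback.lift x (fun α => pullback.lift x (w α.1 α.2) (hw α.1 α.2).symm)
    (fun α => pullback.lift_fst _ _ _), WidePullback.lift_base _ _ _ _, fun α h => ?_⟩
  rw [comp_of_not_D t α h, ← Category.assoc]
  exact (congrArg (· ≫ _) (WidePullback.lift_π _ _ _ _ _)).trans (pullback.lift_snd _ _ _)

/-- The structure map of the modified augmented simplicial scheme. -/
lemma exists_map {k l : AugmentedSimplexCategory} (β : l ⟶ k) :
    ∃ f : t.obj k ⟶ t.obj l, f ≫ t.baseMap l = t.baseMap k ≫ P.map β.op ∧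
      ∀ α : a ⟶ l, f ≫ t.comp α = t.comp (α ≫ β) := by
  obtain ⟨f, hf, hf'⟩ := t.exists_lift (t.baseMap k ≫ P.map β.op)
    -- Here `α ≫ β` may be degenerate although `α` is not; this is why `comp` is defined on all
    -- maps.
    (fun α _ => t.comp (α ≫ β)) (fun α _ => by
      rw [comp_r, op_comp, P.map_comp, Category.assoc])
  refine ⟨f, hf, fun α => ?_⟩
  by_cases h : t.D α
  · rw [comp_of_D t α h, comp_of_D t (α ≫ β) (t.D_comp α β h), lam_comp, reassoc_of% hf]
  · exact hf' α h

/-- The modified augmented simplicial scheme. -/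
noncomputable abbrev functor : AugSimplicialScheme.{u} where
  obj k := t.obj k.unop
  map f := (t.exists_map f.unop).choose
  map_id k := by
    refine t.hom_ext ?_ fun α _ => ?_
    · rw [(t.exists_map _).choose_spec.1]
      simp
    · rw [(t.exists_map _).choose_spec.2]
      simp
  map_comp f g := by
    refine t.hom_ext ?_ fun α _ => ?_
    · rw [(t.exists_map _).choose_spec.1, Category.assoc, (t.exists_map _).choose_spec.1,
        reassoc_of% (t.exists_map _).choose_spec.1]
      simp
    · rw [(t.exists_map _).choose_spec.2, Category.assoc, (t.exists_map _).choose_spec.2,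
        (t.exists_map _).choose_spec.2]
      simp

lemma map_comp {k l : AugmentedSimplexCategory} (β : l ⟶ k) (α : a ⟶ l) :
    t.functor.map β.op ≫ t.comp α = t.comp (α ≫ β) :=
  (t.exists_map β).choose_spec.2 α

/-- The map from the modified augmented simplicial scheme to the given one. -/
noncomputable def toBase : t.functor ⟶ P where
  app k := t.baseMap k.unop
  naturality _ _ f := (t.exists_map f.unop).choose_spec.1

lemma isIso_toBase {k : AugmentedSimplexCategory} (h : ∀ α : a ⟶ k, t.D α) :
    IsIso (t.toBase.app (op k)) := by
  obtain ⟨f, hf, -⟩ := t.exists_lift (𝟙 (P.obj (op k))) (fun α h' => absurd (h α) h')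
    (fun α h' => absurd (h α) h')
  refine ⟨f, t.hom_ext ?_ fun α h' => absurd (h α) h', hf⟩
  rw [Category.assoc, hf]
  exact (Category.comp_id _).trans (Category.id_comp _).symm

/-- With the identity as only index, the fibre product at `a` reduces to the pullback of `W` along
the identity. -/
lemma isIso_comp_id (h : ¬ t.D (𝟙 a)) (h' : ∀ α : a ⟶ a, ¬ t.D α → α = 𝟙 a) :
    IsIso (t.comp (𝟙 a)) := by
  obtain ⟨f, hf, hf'⟩ := t.exists_lift t.r (fun _ _ => 𝟙 t.W) (fun α hα => by
    rw [h' α hα, op_id, P.map_id, Category.id_comp, Category.comp_id])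
  refine ⟨f, t.hom_ext ?_ fun α hα => ?_, hf' _ h⟩
  · rw [Category.assoc, hf, comp_r, op_id, P.map_id, Category.comp_id, Category.id_comp]
  · obtain rfl := h' α hα
    rw [Category.assoc, hf' _ h, Category.comp_id, Category.id_comp]

lemma etSep_baseMap (h : EtSep t.r) (k : AugmentedSimplexCategory) : EtSep (t.baseMap k) := by
  let m (j : WidePullbackShape (t.Index k)) : j ⟶ none := match j with
    | none => 𝟙 _
    | some j => WidePullbackShape.Hom.term j
  let ht : IsTerminal (C := WidePullbackShape (t.Index k)) none :=
    IsTerminal.ofUniqueHom m (fun _ _ => Subsingleton.elim _ _)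
  refine EtSep.of_isLimit ht (fun j => ?_) (limit.isLimit _) none
  cases j with
  | none =>
    rw [Subsingleton.elim (ht.from none) (𝟙 _), CategoryTheory.Functor.map_id]
    exact MorphismProperty.id_mem _ _
  | some j => exact MorphismProperty.pullback_fst _ _ h

/-- The component at `α` has to be `T.map α.op ≫ w`; at degenerate maps the construction prescribes
it through `lam`, which is the compatibility `hD`. -/
lemma exists_lift_functor {T : AugSimplicialScheme.{u}} (g : T ⟶ P) (w : T.obj (op a) ⟶ t.W)
    (hw : w ≫ t.r = g.app (op a))
    (hD : ∀ (k : AugmentedSimplexCategory) (α : a ⟶ k) (h : t.D α),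
      T.map α.op ≫ w = g.app (op k) ≫ t.lam α h) :
    ∃ f : T ⟶ t.functor, f ≫ t.toBase = g ∧
      ∀ (k : AugmentedSimplexCategory) (α : a ⟶ k), f.app (op k) ≫ t.comp α = T.map α.op ≫ w := by
  have hl (k : AugmentedSimplexCategory) := t.exists_lift (g.app (op k))
    (fun α _ => T.map α.op ≫ w) (fun α _ => by rw [Category.assoc, hw, g.naturality])
  choose f hf hf' using hl
  have hf'' (k : AugmentedSimplexCategory) (α : a ⟶ k) : f k ≫ t.comp α = T.map α.op ≫ w := by
    by_cases h : t.D α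
    · rw [hD k α h, comp_of_D t α h, reassoc_of% hf k]
    · exact hf' k α h
  refine ⟨⟨fun k => f k.unop, fun k l β => ?_⟩, ?_, hf''⟩
  · refine t.hom_ext ?_ fun α _ => ?_
    · rw [Category.assoc, hf, Category.assoc]
      refine Eq.trans ?_ (congrArg (f k.unop ≫ ·) (t.toBase.naturality β)).symm
      rw [g.naturality]
      exact (congrArg (· ≫ _) (hf k.unop)).symm.trans (Category.assoc _ _ _)
    · rw [Category.assoc, hf'', Category.assoc]
      refine Eq.trans ?_ (congrArg (f k.unop ≫ ·) (t.map_comp β.unop α)).symm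
      rw [hf'', op_comp, T.map_comp, Category.assoc]
      rfl
  · ext k : 2
    exact hf k.unop

end Attachment

/-! ### Degenerate maps of ordinals -/

/-- A map out of `[n]` is degenerate if it factors through a proper quotient of `[n]`. -/
def IsDegenerate {n : ℕ} {k : AugmentedSimplexCategory} (α : ord n ⟶ k) : Prop :=
  ∃ j : ℕ, j < n ∧ ∃ (σ : SimplexCategory.mk n ⟶ SimplexCategory.mk j) (τ : ord j ⟶ k),
    Epi σ ∧ ordMap σ ≫ τ = α

lemma IsDegenerate.comp {n : ℕ} {k l : AugmentedSimplexCategory} {α : ord n ⟶ k}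
    (h : IsDegenerate α) (β : k ⟶ l) : IsDegenerate (α ≫ β) := by
  obtain ⟨j, hj, σ, τ, hσ, rfl⟩ := h
  exact ⟨j, hj, σ, τ ≫ β, hσ, (Category.assoc _ _ _).symm⟩

lemma isDegenerate_of_epi {n j : ℕ} (hj : j < n) (σ : SimplexCategory.mk n ⟶ SimplexCategory.mk j)
    [hσ : Epi σ] : IsDegenerate (ordMap σ) :=
  ⟨j, hj, σ, 𝟙 _, hσ, Category.comp_id _⟩

lemma exists_epi_mono {n m : ℕ} (α : SimplexCategory.mk n ⟶ SimplexCategory.mk m) :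
    ∃ (j : ℕ) (e : SimplexCategory.mk n ⟶ SimplexCategory.mk j)
      (i : SimplexCategory.mk j ⟶ SimplexCategory.mk m), Epi e ∧ Mono i ∧ e ≫ i = α :=
  ⟨(image α).len, factorThruImage α, image.ι α, inferInstanceAs (Epi (factorThruImage α)),
    inferInstanceAs (Mono (image.ι α)), image.fac α⟩

lemma mono_of_not_isDegenerate {n m : ℕ} (α : SimplexCategory.mk n ⟶ SimplexCategory.mk m)
    (h : ¬ IsDegenerate (ordMap α)) : Mono α := by
  obtain ⟨j, e, i, he, hi, rfl⟩ := exists_epi_mono α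
  obtain hj | rfl := (SimplexCategory.len_le_of_epi e).lt_or_eq
  · exact absurd ⟨j, hj, e, ordMap i, he, rfl⟩ h
  · rw [SimplexCategory.eq_id_of_epi e]
    exact mono_comp _ _

lemma not_isDegenerate_id (n : ℕ) : ¬ IsDegenerate (𝟙 (ord n)) := by
  rintro ⟨j, hj, σ, τ, -, h⟩
  obtain ⟨τ, rfl⟩ := ordMap_surjective τ
  have h' : σ ≫ τ = 𝟙 _ := WithInitial.incl.map_injective h
  have : Mono σ := by
    have : Mono (σ ≫ τ) := by rw [h']; infer_instance
    exact mono_of_mono σ τ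
  exact hj.not_ge (SimplexCategory.len_le_of_mono σ)

lemma eq_id_of_not_isDegenerate {n : ℕ} (α : ord n ⟶ ord n) (h : ¬ IsDegenerate α) :
    α = 𝟙 _ := by
  obtain ⟨α, rfl⟩ := ordMap_surjective α
  have := mono_of_not_isDegenerate α h
  rw [SimplexCategory.eq_id_of_mono α, ordMap_id]

lemma isDegenerate_of_below {n : ℕ} {k : AugmentedSimplexCategory} (hk : below n k)
    (α : ord n ⟶ k) : IsDegenerate α := by
  cases k with
  | star => exact PEmpty.elim α
  | of k =>
    by_contra h
    obtain ⟨α, rfl⟩ := ordMap_surjective (m := k.len) α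
    have := mono_of_not_isDegenerate α h
    exact (SimplexCategory.len_le_of_mono α).not_gt hk

/-- Two factorizations of a map through a surjection are related by passing to the image. -/
lemma exists_common_quotient {n j j' : ℕ} {k : AugmentedSimplexCategory}
    (σ : SimplexCategory.mk n ⟶ SimplexCategory.mk j)
    (σ' : SimplexCategory.mk n ⟶ SimplexCategory.mk j') [Epi σ] [Epi σ'] (τ : ord j ⟶ k)
    (τ' : ord j' ⟶ k) (h : ordMap σ ≫ τ = ordMap σ' ≫ τ') :
    ∃ (q : ℕ) (d : SimplexCategory.mk j ⟶ SimplexCategory.mk q)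
      (d' : SimplexCategory.mk j' ⟶ SimplexCategory.mk q) (i : ord q ⟶ k), Epi d ∧ Epi d' ∧
      σ ≫ d = σ' ≫ d' ∧ ordMap d ≫ i = τ ∧ ordMap d' ≫ i = τ' := by
  cases k with
  | star => exact PEmpty.elim τ
  | of k =>
    obtain ⟨τ, rfl⟩ := ordMap_surjective (m := k.len) τ
    obtain ⟨τ', rfl⟩ := ordMap_surjective (m := k.len) τ'
    have h : σ ≫ τ = σ' ≫ τ' := WithInitial.incl.map_injective h
    -- The common quotient is the image of `τ'`. A section of `σ` expresses `τ` through the same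
    -- image.
    obtain ⟨q, d', i, hd', hi, rfl⟩ := exists_epi_mono τ'
    have := isSplitEpi_of_epi σ
    have hτ : (section_ σ ≫ σ' ≫ d') ≫ i = τ := by
      rw [Category.assoc, Category.assoc, ← h, IsSplitEpi.id_assoc]
    have hσ : σ ≫ section_ σ ≫ σ' ≫ d' = σ' ≫ d' := by
      rw [← cancel_mono i, Category.assoc, hτ, h, Category.assoc]
    have hd : Epi (section_ σ ≫ σ' ≫ d') := by
      have : Epi (σ ≫ section_ σ ≫ σ' ≫ d') := by rw [hσ]; exact epi_comp _ _
      exact epi_of_epi σ _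
    exact ⟨q, section_ σ ≫ σ' ≫ d', d', ordMap i, hd, hd', hσ, congrArg ordMap hτ, rfl⟩

/-! ### Lifting degenerate simplices -/

/-- A surjection of ordinals is a composite of elementary degeneracies, peeled off one at a time. -/
lemma IsMarked.mapsTo_of_epi {P : AugSimplicialScheme.{u}} {B : Marking Ω P} (hP : IsMarked P B)
    {n j : ℕ} (σ : SimplexCategory.mk n ⟶ SimplexCategory.mk j) [hσ : Epi σ] :
    Set.MapsTo (GeomPt.map (P.map (ordMap σ).op)) (B j) (B n) := by
  induction n with
  | zero =>
    have hj : j = 0 := Nat.le_zero.mp (SimplexCategory.len_le_of_epi σ)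
    subst hj
    rw [SimplexCategory.eq_id_of_epi σ, ordMap_id, op_id, P.map_id]
    intro x hx
    rwa [GeomPt.map_id]
  | succ n ih =>
    by_cases hi : Function.Injective σ.toOrderHom
    · have := SimplexCategory.mono_iff_injective.mpr hi
      obtain rfl : j = n + 1 := le_antisymm (SimplexCategory.len_le_of_epi σ)
        (SimplexCategory.len_le_of_mono σ)
      rw [SimplexCategory.eq_id_of_epi σ, ordMap_id, op_id, P.map_id]
      intro x hx
      rwa [GeomPt.map_id]
    · obtain ⟨i, θ, rfl⟩ := SimplexCategory.eq_σ_comp_of_not_injective σ hi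
      have : Epi θ := epi_of_epi (SimplexCategory.σ i) θ
      intro x hx
      have e : P.map (ordMap (SimplexCategory.σ i ≫ θ)).op =
          P.map (ordMap θ).op ≫ P.map (ordMap (SimplexCategory.σ i)).op := by
        rw [← P.map_comp]; rfl
      rw [e, GeomPt.map_comp]
      exact hP.degeneracy n i (ih θ hx)

/-- The attachment `t` makes the term of `P` in degree `n` free on its marked points. -/
structure Attachment.IsFree {P : AugSimplicialScheme.{u}} {n : ℕ} (t : Attachment P (ord n))
    (B : Marking Ω P) (S : Set (GeomPt Ω t.W)) : Prop where
  D_iff {k : AugmentedSimplexCategory} (α : ord n ⟶ k) : t.D α ↔ IsDegenerate α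
  etSep : EtSep t.r
  free : Free t.W S
  bijOn : Set.BijOn (GeomPt.map t.r) S (B n)
  exists_lift {T : Scheme.{u}} {S' : Set (GeomPt Ω T)} (hT : Free T S')
    (g : T ⟶ P.obj (op (ord n))) (hg : Set.MapsTo (GeomPt.map g) S' (B n)) :
    ∃ l : T ⟶ t.W, l ≫ t.r = g ∧ Set.MapsTo (GeomPt.map l) S' S
  mapsTo_lam {j : ℕ} (σ : SimplexCategory.mk n ⟶ SimplexCategory.mk j) (h : t.D (ordMap σ))
    (hσ : Epi σ) : Set.MapsTo (GeomPt.map (t.lam (ordMap σ) h)) (B j) S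

/-- `W` comes from the components of the marked points in degree `n`. Freeness is known only below
`n`, so a lift along a degenerate map is built by factoring it through a proper quotient `[j]`,
lifting from the free term in degree `j`, and composing. -/
lemma IsMarked.exists_attachment {P : AugSimplicialScheme.{u}} {B : Marking Ω P}
    (hP : IsMarked P B) [hN : IsLocallyNoetherian (P.obj (op WithInitial.star))] {n : ℕ}
    (hF : ∀ j < n, Free (P.obj (op (ord j))) (B j)) :
    ∃ (t : Attachment P (ord n)) (S : Set (GeomPt Ω t.W)), t.IsFree B S := by
  have : IsLocallyNoetherian (P.obj (op (ord n))) := by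
    have := (hP.etSep (ord n)).1
    exact LocallyOfFiniteType.isLocallyNoetherian (P.map (fromStar (ord n)).op)
  obtain ⟨W, r, S, hr, hW, hS, hl⟩ := exists_free (B n)
  have uniq {T : Scheme.{u}} {S' : Set (GeomPt Ω T)} (hT : Free T S') {l l' : T ⟶ W}
      (h : l ≫ r = l' ≫ r) (h1 : Set.MapsTo (GeomPt.map l) S' S)
      (h2 : Set.MapsTo (GeomPt.map l') S' S) : l = l' :=
    hT.hom_ext r hr h fun x hx => hS.injOn (h1 hx) (h2 hx) (by
      rw [← GeomPt.map_comp, ← GeomPt.map_comp, h])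
  have hm (j : ℕ) (hj : j < n) (σ : SimplexCategory.mk n ⟶ SimplexCategory.mk j) (hσ : Epi σ) :=
    hl (hF j hj) (P.map (ordMap σ).op) (hP.mapsTo_of_epi σ)
  choose m hm hm' using hm
  have hcomp {j q : ℕ} (hj : j < n) (hq : q < n) (σ : SimplexCategory.mk n ⟶ SimplexCategory.mk j)
      (hσ : Epi σ) (d : SimplexCategory.mk j ⟶ SimplexCategory.mk q) (hd : Epi d)
      (ρ : SimplexCategory.mk n ⟶ SimplexCategory.mk q) (hρ : Epi ρ) (h : σ ≫ d = ρ) :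
      P.map (ordMap d).op ≫ m j hj σ hσ = m q hq ρ hρ := by
    refine uniq (hF q hq) ?_ (fun x hx => ?_) (hm' q hq ρ hρ)
    · rw [Category.assoc, hm, hm, ← P.map_comp, ← h]
      rfl
    · rw [GeomPt.map_comp]
      exact hm' j hj σ hσ (hP.mapsTo_of_epi d hx)
  -- Independence of the factorization: both lifts are compared over a common quotient `[q]` with `q
  -- < n`, where freeness makes them unique.
  have hwd {j j' : ℕ} {k : AugmentedSimplexCategory} (hj : j < n) (hj' : j' < n)
      (σ : SimplexCategory.mk n ⟶ SimplexCategory.mk j) (hσ : Epi σ)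
      (σ' : SimplexCategory.mk n ⟶ SimplexCategory.mk j') (hσ' : Epi σ') (τ : ord j ⟶ k)
      (τ' : ord j' ⟶ k) (h : ordMap σ ≫ τ = ordMap σ' ≫ τ') :
      P.map τ.op ≫ m j hj σ hσ = P.map τ'.op ≫ m j' hj' σ' hσ' := by
    obtain ⟨q, d, d', i, hd, hd', hdd, rfl, rfl⟩ := exists_common_quotient σ σ' τ τ' h
    have hq : q < n := (SimplexCategory.len_le_of_epi d).trans_lt hj
    rw [op_comp, P.map_comp, op_comp, P.map_comp, Category.assoc, Category.assoc,
      hcomp hj hq σ hσ d hd (σ ≫ d) (epi_comp _ _) rfl,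
      hcomp hj' hq σ' hσ' d' hd' (σ ≫ d) (epi_comp _ _) hdd.symm]
  have hlam {k : AugmentedSimplexCategory} (α : ord n ⟶ k) (h : IsDegenerate α) :
      ∃ l : P.obj (op k) ⟶ W, ∀ (j : ℕ) (hj : j < n)
        (σ : SimplexCategory.mk n ⟶ SimplexCategory.mk j) (hσ : Epi σ) (τ : ord j ⟶ k),
        ordMap σ ≫ τ = α → l = P.map τ.op ≫ m j hj σ hσ := by
    obtain ⟨j, hj, σ, τ, hσ, rfl⟩ := h
    exact ⟨P.map τ.op ≫ m j hj σ hσ, fun j' hj' σ' hσ' τ' h' =>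
      hwd hj hj' σ hσ σ' hσ' τ τ' h'.symm⟩
  choose lam hlam using @hlam
  let t : Attachment P (ord n) :=
    { W := W
      r := r
      D := IsDegenerate
      lam := lam
      lam_r := by
        intro k α h
        obtain ⟨j, hj, σ, τ, hσ, rfl⟩ := id h
        rw [hlam _ h j hj σ hσ τ rfl, Category.assoc, hm, ← P.map_comp]
        rfl
      D_comp α β h := h.comp β
      lam_comp := by
        intro k l α β h
        obtain ⟨j, hj, σ, τ, hσ, rfl⟩ := id h
        rw [hlam _ h j hj σ hσ τ rfl, hlam _ (h.comp β) j hj σ hσ (τ ≫ β)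
          (Category.assoc _ _ _).symm, op_comp, P.map_comp, Category.assoc] }
  refine ⟨t, S, fun _ => Iff.rfl, hr, hW, hS, hl, fun {j} σ h hσ => ?_⟩
  have hj : j < n := by
    by_contra hj
    obtain rfl : j = n := le_antisymm (SimplexCategory.len_le_of_epi σ) (not_lt.mp hj)
    rw [SimplexCategory.eq_id_of_epi σ] at h
    exact not_isDegenerate_id _ h
  have e : t.lam (ordMap σ) h = m j hj σ hσ := by
    refine (hlam _ h j hj σ hσ (𝟙 _) (Category.comp_id _)).trans ?_
    rw [op_id, P.map_id, Category.id_comp]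
  rw [e]
  exact hm' j hj σ hσ

/-- Freeness transfers along isomorphisms. -/
lemma Free.of_isIso {A A' : Scheme.{u}} {S : Set (GeomPt Ω A)} {S' : Set (GeomPt Ω A')}
    (f : A ⟶ A') [IsIso f] (h : Free A' S') (hS : ∀ x, x ∈ S ↔ x.map f ∈ S') : Free A S := by
  obtain ⟨c⟩ := h
  obtain ⟨hc⟩ := c.isCoproduct
  let s (x : S') : GeomPt Ω A := x.1.map (inv f)
  have hs (x : S') : (s x).map f = x.1 := by
    rw [← GeomPt.map_comp, IsIso.inv_hom_id, GeomPt.map_id]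
  let d : PointedDecomp A s :=
    { component := c.component
      ι x := c.ι x ≫ inv f
      isCoproduct := ⟨IsColimit.ofIsoColimit hc (Cofan.ext (asIso (inv f)) fun _ => rfl)⟩
      connected := c.connected
      base := c.base
      base_map x := by rw [GeomPt.map_comp, c.base_map] }
  have hinj : Function.Injective s := fun x y h => Subtype.ext (by rw [← hs x, h, hs y])
  convert d.free hinj
  ext x
  rw [hS]
  constructor
  · intro hx
    exact ⟨⟨_, hx⟩, by simp only [s]; rw [← GeomPt.map_comp, IsIso.hom_inv_id, GeomPt.map_id]⟩
  · rintro ⟨y, rfl⟩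
    rw [hs]
    exact y.2

/-! ### Marked points of the modified augmented simplicial scheme -/

namespace Attachment

variable {P : AugSimplicialScheme.{u}}

lemma geomPt_ext {a : AugmentedSimplexCategory} (t : Attachment P a)
    {k : AugmentedSimplexCategory} {x y : GeomPt Ω (t.obj k)}
    (h : x.map (t.baseMap k) = y.map (t.baseMap k))
    (h' : ∀ α : a ⟶ k, ¬ t.D α → x.map (t.comp α) = y.map (t.comp α)) : x = y := by
  obtain ⟨i, x⟩ := x
  obtain ⟨j, y⟩ := y
  obtain rfl : i = j := congrArg GeomPt.i h
  rw [t.hom_ext (GeomPt.map_eq_map_iff.mp h) fun α hα => GeomPt.map_eq_map_iff.mp (h' α hα)]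

lemma exists_geomPt {a : AugmentedSimplexCategory} (t : Attachment P a)
    {k : AugmentedSimplexCategory} (p : GeomPt Ω (P.obj (op k)))
    (w : ∀ α : a ⟶ k, ¬ t.D α → GeomPt Ω t.W)
    (hw : ∀ (α : a ⟶ k) (h : ¬ t.D α), (w α h).map t.r = p.map (P.map α.op)) :
    ∃ x : GeomPt Ω (t.obj k), x.map (t.baseMap k) = p ∧
      ∀ (α : a ⟶ k) (h : ¬ t.D α), x.map (t.comp α) = w α h := by
  obtain ⟨i, p⟩ := p
  have h (α : a ⟶ k) (hα : ¬ t.D α) : ∃ v : Spec (CommRingCat.of (Ω i)) ⟶ t.W,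
      w α hα = ⟨i, v⟩ := by
    obtain hi := congrArg GeomPt.i (hw α hα)
    generalize w α hα = z at hi
    obtain ⟨j, z⟩ := z
    obtain rfl : j = i := hi
    exact ⟨z, rfl⟩
  choose v hv using h
  obtain ⟨f, hf, hf'⟩ := t.exists_lift p v fun α hα =>
    GeomPt.map_eq_map_iff.mp ((hv α hα) ▸ hw α hα)
  refine ⟨⟨i, f⟩, congrArg (GeomPt.mk i) hf, fun α hα => ?_⟩
  rw [hv]
  exact congrArg (GeomPt.mk i) (hf' α hα)

variable {n : ℕ} (t : Attachment P (ord n))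

/-- The marked points of the modified augmented simplicial scheme. -/
def marking (B : Marking Ω P) (S : Set (GeomPt Ω t.W)) : Marking Ω t.functor := fun k =>
  {x | x.map (t.baseMap (ord k)) ∈ B k ∧
    ∀ α : SimplexCategory.mk n ⟶ SimplexCategory.mk k, Epi α → x.map (t.comp (ordMap α)) ∈ S}

variable {t} {B : Marking Ω P} {S : Set (GeomPt Ω t.W)}

namespace IsFree

lemma isIso_toBase (ht : t.IsFree B S) {k : AugmentedSimplexCategory} (hk : below n k) :
    IsIso (t.toBase.app (op k)) :=
  t.isIso_toBase fun α => (ht.D_iff α).mpr (isDegenerate_of_below hk α)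

lemma isIso_comp_id (ht : t.IsFree B S) : IsIso (t.comp (𝟙 (ord n))) :=
  t.isIso_comp_id (fun h => not_isDegenerate_id n ((ht.D_iff _).mp h))
    fun α h => eq_id_of_not_isDegenerate α fun h' => h ((ht.D_iff α).mpr h')

/-- The condition on `S` in `marking` matters only in degree `n`. Below `n` it is automatic, since
surjections from `[n]` are degenerate and `lam` preserves marked points; above `n` there are no
surjections from `[n]`. -/
lemma mem_marking_of_lt (ht : t.IsFree B S) {k : ℕ} (hk : k < n) {x : GeomPt Ω (t.obj (ord k))} :
    x ∈ t.marking B S k ↔ x.map (t.baseMap (ord k)) ∈ B k := by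
  refine ⟨fun h => h.1, fun h => ⟨h, fun α hα => ?_⟩⟩
  have hα' := (ht.D_iff (ordMap α)).mpr (isDegenerate_of_epi hk α)
  rw [t.comp_of_D _ hα', GeomPt.map_comp]
  exact ht.mapsTo_lam α hα' hα h

lemma mem_marking_self (ht : t.IsFree B S) {x : GeomPt Ω (t.obj (ord n))} :
    x ∈ t.marking B S n ↔ x.map (t.comp (𝟙 (ord n))) ∈ S := by
  refine ⟨fun h => h.2 (𝟙 _) inferInstance, fun h => ⟨?_, fun α hα => ?_⟩⟩
  · have := ht.bijOn.mapsTo h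
    rw [← GeomPt.map_comp, comp_r, op_id, P.map_id, Category.comp_id] at this
    exact this
  · rw [SimplexCategory.eq_id_of_epi α]
    exact h

lemma mem_marking_of_gt {k : ℕ} (hk : n < k) {x : GeomPt Ω (t.obj (ord k))} :
    x ∈ t.marking B S k ↔ x.map (t.baseMap (ord k)) ∈ B k :=
  ⟨fun h => h.1, fun h => ⟨h, fun α _ => absurd hk (SimplexCategory.len_le_of_epi α).not_gt⟩⟩

lemma map_comp_id {k : AugmentedSimplexCategory} (α : ord n ⟶ k) :
    t.functor.map α.op ≫ t.comp (𝟙 (ord n)) = t.comp α :=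
  (t.map_comp α (𝟙 _)).trans (by rw [Category.id_comp])

lemma coskπ_baseMap {k : ℕ} {l : AugmentedSimplexCategory} (hl : below k l) (γ : l ⟶ ord k)
    (z : GeomPt Ω (cosk t.functor k)) :
    (z.map (coskπ t.functor hl γ)).map (t.baseMap l) =
      (z.map (coskMap t.toBase k)).map (coskπ P hl γ) := by
  rw [← GeomPt.map_comp, ← GeomPt.map_comp, coskMap_coskπ]
  rfl

lemma map_baseMap {k l : AugmentedSimplexCategory} (γ : l ⟶ k) (x : GeomPt Ω (t.obj k)) :
    (x.map (t.functor.map γ.op)).map (t.baseMap l) =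
      (x.map (t.baseMap k)).map (P.map γ.op) := by
  rw [← GeomPt.map_comp, ← GeomPt.map_comp]
  exact congrArg (GeomPt.map · x) (t.toBase.naturality γ.op)

/-- The point of `P` is determined because `P` is marked. The components in `W` are visible in the
coskeleton when `n < k`, determined by injectivity of `S` to `B n` when `k = n`, and absent when `k
< n`. -/
lemma injOn (ht : t.IsFree B S) (hP : IsMarked P B) (k : ℕ) :
    Set.InjOn (GeomPt.map (toCosk t.functor k)) (t.marking B S k) := by
  intro x hx y hy h
  have hb : x.map (t.baseMap (ord k)) = y.map (t.baseMap (ord k)) := by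
    refine hP.eq_of_map_eq hx.1 hy.1 ?_
    have e : toCosk t.functor k ≫ coskMap t.toBase k = t.baseMap (ord k) ≫ toCosk P k :=
      toCosk_coskMap t.toBase k
    rw [← GeomPt.map_comp, ← GeomPt.map_comp, ← e, GeomPt.map_comp, h, GeomPt.map_comp]
  refine t.geomPt_ext hb fun α hα => ?_
  obtain hk | rfl | hk := lt_trichotomy n k
  · have e : t.comp α = toCosk t.functor k ≫ coskπ t.functor (below_ord.mpr hk) α ≫
        t.comp (𝟙 (ord n)) := by
      rw [reassoc_of% toCosk_coskπ (A := t.functor) (below_ord.mpr hk) α, map_comp_id]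
    rw [e, GeomPt.map_comp, h, ← GeomPt.map_comp]
  · obtain rfl := eq_id_of_not_isDegenerate α fun h => hα ((ht.D_iff α).mpr h)
    refine ht.bijOn.injOn (ht.mem_marking_self.mp hx) (ht.mem_marking_self.mp hy) ?_
    rw [← GeomPt.map_comp, ← GeomPt.map_comp, comp_r, GeomPt.map_comp, hb, GeomPt.map_comp]
  · exact absurd ((ht.D_iff α).mpr (isDegenerate_of_below (below_ord.mpr hk) α)) hα

/-- A geometric point of the coskeleton determines its components at degenerate maps. -/
lemma coskπ_comp_of_D (ht : t.IsFree B S) {k : ℕ} (hk : n < k) (z : GeomPt Ω (cosk t.functor k))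
    (p : GeomPt Ω (P.obj (op (ord k)))) (hp : p.map (toCosk P k) = z.map (coskMap t.toBase k))
    (β : ord n ⟶ ord k) (h : t.D β) :
    (z.map (coskπ t.functor (below_ord.mpr hk) β)).map (t.comp (𝟙 (ord n))) =
      p.map (t.lam β h) := by
  obtain ⟨j, hj, σ, τ, hσ, rfl⟩ := (ht.D_iff β).mp h
  have hσ' : t.D (ordMap σ) := (ht.D_iff _).mpr (isDegenerate_of_epi hj σ)
  have hjk : below k (ord j) := below_ord.mpr (hj.trans hk)
  have e : coskπ t.functor (below_ord.mpr hk) (ordMap σ ≫ τ) ≫ t.comp (𝟙 (ord n)) =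
      coskπ t.functor hjk τ ≫ t.baseMap (ord j) ≫ t.lam (ordMap σ) hσ' := by
    rw [← coskπ_map hjk (below_ord.mpr hk), Category.assoc, map_comp_id, t.comp_of_D _ hσ']
  rw [← GeomPt.map_comp, e, GeomPt.map_comp, GeomPt.map_comp, coskπ_baseMap, ← hp,
    ← GeomPt.map_comp (toCosk P k), toCosk_coskπ, ← GeomPt.map_comp]
  exact congrArg (GeomPt.map · p) (t.lam_comp (ordMap σ) τ hσ').symm

/-- Over the marked lift `p` in `P`, the components in `W` are read off from `z` when `n < k`, given
by the point of `S` over `p` when `k = n`, and absent when `k < n`. -/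
lemma surjOn (ht : t.IsFree B S) (hP : IsMarked P B) (k : ℕ) :
    Set.SurjOn (GeomPt.map (toCosk t.functor k)) (t.marking B S k) Set.univ := by
  intro z _
  obtain ⟨p, hpB, hp⟩ := (hP.bijOn k).surjOn (Set.mem_univ (z.map (coskMap t.toBase k)))
  have hp' {l : AugmentedSimplexCategory} (hl : below k l) (γ : l ⟶ ord k) :
      (z.map (coskπ t.functor hl γ)).map (t.baseMap l) = p.map (P.map γ.op) := by
    rw [coskπ_baseMap, ← hp, ← GeomPt.map_comp, toCosk_coskπ]
  suffices H : ∃ x ∈ t.marking B S k, x.map (t.baseMap (ord k)) = p ∧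
      ∀ hk : n < k, ∀ β : ord n ⟶ ord k, x.map (t.comp β) =
        (z.map (coskπ t.functor (below_ord.mpr hk) β)).map (t.comp (𝟙 (ord n))) by
    obtain ⟨x, hx, hxp, hxc⟩ := H
    refine ⟨x, hx, GeomPt.cosk_ext fun l hl γ => ?_⟩
    rw [← GeomPt.map_comp, toCosk_coskπ]
    refine t.geomPt_ext ?_ fun α hα => ?_
    · rw [map_baseMap, hxp, hp']
    · have hk : n < k := by
        by_contra hk
        refine hα ((ht.D_iff α).mpr (isDegenerate_of_below ?_ α))
        cases l with
        | star => trivial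
        | of l => exact lt_of_lt_of_le hl (not_lt.mp hk)
      rw [← GeomPt.map_comp, t.map_comp γ α, hxc hk, ← coskπ_map hl, ← GeomPt.map_comp,
        ← GeomPt.map_comp, Category.assoc, map_comp_id]
  obtain hk | rfl | hk := lt_trichotomy n k
  · obtain ⟨x, hx, hx'⟩ := t.exists_geomPt p
      (fun β _ => (z.map (coskπ t.functor (below_ord.mpr hk) β)).map (t.comp (𝟙 (ord n))))
      (fun β _ => by
        rw [← GeomPt.map_comp _ t.r, comp_r, op_id, P.map_id, Category.comp_id]
        exact hp' _ β)
    refine ⟨x, (mem_marking_of_gt hk).mpr (hx ▸ hpB), hx, fun _ β => ?_⟩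
    by_cases hβ : t.D β
    · rw [t.comp_of_D _ hβ, GeomPt.map_comp, hx, coskπ_comp_of_D ht hk z p hp β hβ]
    · exact hx' β hβ
  · obtain ⟨s, hs, hsp⟩ := ht.bijOn.surjOn hpB
    obtain ⟨x, hx, hx'⟩ := t.exists_geomPt p (fun _ _ => s) (fun β hβ => by
      rw [eq_id_of_not_isDegenerate β fun h => hβ ((ht.D_iff β).mpr h), op_id, P.map_id,
        GeomPt.map_id]
      exact hsp)
    refine ⟨x, ht.mem_marking_self.mpr ?_, hx, fun hk => absurd hk (lt_irrefl _)⟩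
    rw [hx' _ fun h => not_isDegenerate_id n ((ht.D_iff _).mp h)]
    exact hs
  · obtain ⟨x, hx, -⟩ := t.exists_geomPt p
      (fun β hβ => absurd ((ht.D_iff β).mpr (isDegenerate_of_below (below_ord.mpr hk) β)) hβ)
      (fun β hβ => absurd ((ht.D_iff β).mpr (isDegenerate_of_below (below_ord.mpr hk) β)) hβ)
    exact ⟨x, (ht.mem_marking_of_lt hk).mpr (hx ▸ hpB), hx, fun hk' => absurd hk hk'.not_gt⟩

lemma isMarked (ht : t.IsFree B S) (hP : IsMarked P B) : IsMarked t.functor (t.marking B S) where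
  etSep k := by
    refine MorphismProperty.of_postcomp EtSep _ (t.baseMap .star)
      (t.etSep_baseMap ht.etSep _) ?_
    have e : t.functor.map (fromStar k).op ≫ t.baseMap .star =
      t.baseMap k ≫ P.map (fromStar k).op := t.toBase.naturality (fromStar k).op
    rw [e]
    exact MorphismProperty.comp_mem _ _ _ (t.etSep_baseMap ht.etSep k) (hP.etSep k)
  bijOn k := ⟨fun _ _ => trivial, ht.injOn hP k, ht.surjOn hP k⟩
  degeneracy k i := by
    intro x hx
    refine ⟨?_, fun α hα => ?_⟩
    · rw [map_baseMap]
      exact hP.degeneracy k i hx.1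
    · rw [← GeomPt.map_comp, t.map_comp]
      exact hx.2 (α ≫ SimplexCategory.σ i) (epi_comp _ _)

lemma free_of_lt (ht : t.IsFree B S) {k : ℕ} (hk : k < n)
    (hF : Free (P.obj (op (ord k))) (B k)) :
    Free (t.functor.obj (op (ord k))) (t.marking B S k) := by
  have := ht.isIso_toBase (below_ord.mpr hk)
  exact Free.of_isIso (t.toBase.app (op (ord k))) hF fun x => ht.mem_marking_of_lt hk

lemma free_self (ht : t.IsFree B S) :
    Free (t.functor.obj (op (ord n))) (t.marking B S n) := by
  have := ht.isIso_comp_id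
  exact Free.of_isIso (t.comp (𝟙 (ord n))) ht.free fun x => ht.mem_marking_self

/-- Freeness of `T` in degree `n` lifts `g` to `W`. Compatibility with `lam` reduces to surjections
onto `[j]` with `j < n`, where two lifts agree because `T` is free in degree `j`. -/
lemma exists_preservesMarking (ht : t.IsFree B S) {T : AugSimplicialScheme.{u}}
    {BT : Marking Ω T} (hT : IsMarked T BT) (hF : ∀ k, Free (T.obj (op (ord k))) (BT k))
    (g : T ⟶ P) (hg : PreservesMarking BT B g) :
    ∃ f : T ⟶ t.functor, PreservesMarking BT (t.marking B S) f ∧ f ≫ t.toBase = g := by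
  obtain ⟨w, hw, hw'⟩ := ht.exists_lift (hF n) (g.app (op (ord n))) (hg n)
  have hσ {j : ℕ} (hj : j < n) (σ : SimplexCategory.mk n ⟶ SimplexCategory.mk j) (hσ : Epi σ)
      (h : t.D (ordMap σ)) :
      T.map (ordMap σ).op ≫ w = g.app (op (ord j)) ≫ t.lam (ordMap σ) h := by
    have e : (T.map (ordMap σ).op ≫ w) ≫ t.r =
        (g.app (op (ord j)) ≫ t.lam (ordMap σ) h) ≫ t.r := by
      rw [Category.assoc, hw, g.naturality, Category.assoc, t.lam_r]
    refine (hF j).hom_ext t.r ht.etSep e fun x hx => ht.bijOn.injOn ?_ ?_ ?_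
    · rw [GeomPt.map_comp]
      exact hw' (hT.mapsTo_of_epi σ hx)
    · rw [GeomPt.map_comp]
      exact ht.mapsTo_lam σ h hσ (hg j hx)
    · rw [← GeomPt.map_comp, ← GeomPt.map_comp, e]
  obtain ⟨f, hf, hf'⟩ := t.exists_lift_functor g w hw fun k α h => by
    obtain ⟨j, hj, σ, τ, hσe, rfl⟩ := (ht.D_iff α).mp h
    have h' : t.D (ordMap σ) := (ht.D_iff _).mpr (isDegenerate_of_epi hj σ)
    rw [op_comp, T.map_comp, Category.assoc, hσ hj σ hσe h', ← Category.assoc, g.naturality,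
      Category.assoc, ← t.lam_comp]
  refine ⟨f, fun k x hx => ⟨?_, fun α hα => ?_⟩, hf⟩
  · rw [← GeomPt.map_comp]
    have e : f.app (op (ord k)) ≫ t.baseMap (ord k) = g.app (op (ord k)) :=
      NatTrans.congr_app hf (op (ord k))
    rw [e]
    exact hg k hx
  · rw [← GeomPt.map_comp, hf', GeomPt.map_comp]
    exact hw' (hT.mapsTo_of_epi α hx)

end IsFree
end Attachment

/-- Making a marked augmented simplicial scheme free in one more degree. -/
lemma IsMarked.exists_free_step {P : AugSimplicialScheme.{u}} {B : Marking Ω P}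
    (hP : IsMarked P B) [IsLocallyNoetherian (P.obj (op WithInitial.star))] {n : ℕ}
    (hF : ∀ j < n, Free (P.obj (op (ord j))) (B j)) :
    ∃ (E : AugSimplicialScheme.{u}) (C : Marking Ω E) (π : E ⟶ P), IsMarked E C ∧
      (∀ j < n + 1, Free (E.obj (op (ord j))) (C j)) ∧
      (∀ k, below n k → IsIso (π.app (op k))) ∧ PreservesMarking C B π ∧
      (∀ j < n, ∀ x : GeomPt Ω (E.obj (op (ord j))), x.map (π.app (op (ord j))) ∈ B j → x ∈ C j) ∧
      ∀ {T : AugSimplicialScheme.{u}} {BT : Marking Ω T} (_ : IsMarked T BT)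
        (_ : ∀ k, Free (T.obj (op (ord k))) (BT k)) (g : T ⟶ P) (_ : PreservesMarking BT B g),
        ∃ f : T ⟶ E, PreservesMarking BT C f ∧ f ≫ π = g := by
  obtain ⟨t, S, ht⟩ := hP.exists_attachment hF
  refine ⟨t.functor, t.marking B S, t.toBase, ht.isMarked hP, fun j hj => ?_,
    fun k hk => ht.isIso_toBase hk, fun k x hx => hx.1,
    fun j hj x hx => (ht.mem_marking_of_lt hj).mpr hx,
    fun hT hF g hg => ht.exists_preservesMarking hT hF g hg⟩
  obtain hj | rfl := (Nat.lt_succ_iff.mp hj).lt_or_eq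
  · exact ht.free_of_lt hj (hF j hj)
  · exact ht.free_self

/-! ### Limits of degreewise eventually constant towers -/

lemma below_mono {n m : ℕ} (h : n ≤ m) {k : AugmentedSimplexCategory} (hk : below n k) :
    below m k := by
  cases k with
  | star => trivial
  | of k => exact lt_of_lt_of_le (show k.len < n from hk) h

lemma exists_below (k : AugmentedSimplexCategory) : ∃ n, below n k := by
  cases k with
  | star => exact ⟨0, trivial⟩
  | of k => exact ⟨k.len + 1, Nat.lt_succ_self k.len⟩

/-- In each degree the tower is eventually constant, so its limit exists degreewise and is reached
at a finite stage. -/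
lemma exists_limit_tower (A : ℕ → AugSimplicialScheme.{u}) (π : ∀ n, A (n + 1) ⟶ A n)
    (h : ∀ n k, below n k → IsIso ((π n).app (op k))) :
    ∃ (L : AugSimplicialScheme.{u}) (p : ∀ n, L ⟶ A n), (∀ n, p (n + 1) ≫ π n = p n) ∧
      (∀ n k, below n k → IsIso ((p n).app (op k))) ∧
      ∀ {T : AugSimplicialScheme.{u}} (g : ∀ n, T ⟶ A n), (∀ n, g (n + 1) ≫ π n = g n) →
        ∃ f : T ⟶ L, ∀ n, f ≫ p n = g n := by
  let F := Functor.ofOpSequence π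
  have hF (n : ℕ) : F.map (homOfLE (Nat.le_add_right n 1)).op = π n :=
    Functor.ofOpSequence_map_homOfLE_succ π n
  have hiso (n : ℕ) (k : AugmentedSimplexCategory) (hk : below n k) (m : ℕ) (hm : n ≤ m) :
      IsIso ((F.map (homOfLE hm).op).app (op k)) := by
    induction m, hm using Nat.le_induction with
    | base =>
      have e : (homOfLE (le_refl n)).op = 𝟙 (op n) := rfl
      rw [e, F.map_id]
      exact inferInstanceAs (IsIso (𝟙 _))
    | succ m hm ih =>
      have e : (homOfLE (Nat.le_succ_of_le hm)).op =
        (homOfLE (Nat.le_add_right m 1)).op ≫ (homOfLE hm).op := rfl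
      have h' : IsIso ((F.map (homOfLE (Nat.le_add_right m 1)).op).app (op k)) := by
        rw [hF]
        exact h m k (below_mono hm hk)
      rw [e, F.map_comp, NatTrans.comp_app]
      exact IsIso.comp_isIso
  have hconst (n : ℕ) (k : AugmentedSimplexCategory) (hk : below n k) :
      (F ⋙ (evaluation _ _).obj (op k)).IsEventuallyConstantTo (op n) := fun m f =>
    hiso n k hk m.unop (leOfHom f.unop)
  have (k : AugmentedSimplexCategoryᵒᵖ) : HasLimit (F.flip.obj k) := by
    obtain ⟨n, hn⟩ := exists_below k.unop
    exact (hconst n k.unop hn).hasLimit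
  refine ⟨limit F, fun n => limit.π F (op n), fun n => ?_, fun n k hk => ?_, fun g hg => ?_⟩
  · rw [← hF]
    exact limit.w F _
  · exact (hconst n k hk).isIso_π_of_isLimit
      (isLimitOfPreserves ((evaluation _ _).obj (op k)) (limit.isLimit F))
  · refine ⟨limit.lift F ⟨_, NatTrans.ofOpSequence (F := (Functor.const _).obj _) (G := F) g
      fun n => ?_⟩, fun n => limit.lift_π _ _⟩
    rw [hF]
    exact (Category.id_comp _).trans (hg n).symm

lemma isIso_coskMap {A A' : AugSimplicialScheme.{u}} (g : A ⟶ A') {n : ℕ}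
    (h : ∀ k, below n k → IsIso (g.app (op k))) : IsIso (coskMap g n) := by
  have (j : StructuredArrow (op (ord n)) (belowIncl n)) :
      IsIso ((Functor.whiskerLeft (StructuredArrow.proj (op (ord n)) (belowIncl n))
        (Functor.whiskerLeft (belowIncl n) g)).app j) :=
    h _ j.right.unop.property
  have := NatIso.isIso_of_isIso_app (Functor.whiskerLeft (StructuredArrow.proj (op (ord n))
    (belowIncl n)) (Functor.whiskerLeft (belowIncl n) g))
  exact isIso_limMap _

lemma GeomPt.map_bijective {X Y : Scheme.{u}} (f : X ⟶ Y) [IsIso f] :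
    Function.Bijective (GeomPt.map (Ω := Ω) f) :=
  ⟨GeomPt.map_injective f, fun y => ⟨y.map (inv f), by
    rw [← GeomPt.map_comp, IsIso.inv_hom_id, GeomPt.map_id]⟩⟩

/-- A marked augmented simplicial scheme is determined by its approximations. -/
lemma IsMarked.of_approximation {L : AugSimplicialScheme.{u}} {C : Marking Ω L}
    {A : ℕ → AugSimplicialScheme.{u}} {B : ∀ n, Marking Ω (A n)} (hA : ∀ n, IsMarked (A n) (B n))
    (p : ∀ n, L ⟶ A n) (hp : ∀ n k, below n k → IsIso ((p n).app (op k)))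
    (hC : ∀ n, ∀ k < n, ∀ x, x ∈ C k ↔ x.map ((p n).app (op (ord k))) ∈ B n k) :
    IsMarked L C where
  etSep k := by
    obtain ⟨n, hn⟩ := exists_below k
    have := hp n k hn
    have := hp n .star (below_star n)
    refine MorphismProperty.of_postcomp EtSep _ ((p n).app (op .star))
      (EtSep.of_isOpenImmersion _) ?_
    rw [(p n).naturality]
    exact MorphismProperty.comp_mem _ _ _ (EtSep.of_isOpenImmersion _) ((hA n).etSep k)
  bijOn k := by
    -- Stage `k + 1` agrees with `L` in all degrees up to `k`, hence also on the coskeleton below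
    -- degree `k`.
    have := hp (k + 1) (ord k) (below_ord.mpr (Nat.lt_succ_self k))
    have := isIso_coskMap (p (k + 1)) (n := k) fun l hl => hp _ _ (below_mono (Nat.le_succ k) hl)
    have e : toCosk L k = (p (k + 1)).app (op (ord k)) ≫ toCosk (A (k + 1)) k ≫
        inv (coskMap (p (k + 1)) k) := by
      rw [← Category.assoc, IsIso.eq_comp_inv, toCosk_coskMap]
    have hb := (hA (k + 1)).bijOn k
    have h1 := GeomPt.map_bijective (Ω := Ω) ((p (k + 1)).app (op (ord k)))
    have h2 := GeomPt.map_bijective (Ω := Ω) (inv (coskMap (p (k + 1)) k))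
    have hCk := hC (k + 1) k (Nat.lt_succ_self k)
    have e' (x : GeomPt Ω (L.obj (op (ord k)))) : x.map (toCosk L k) =
        ((x.map ((p (k + 1)).app (op (ord k)))).map (toCosk (A (k + 1)) k)).map
          (inv (coskMap (p (k + 1)) k)) := by
      rw [e, GeomPt.map_comp, GeomPt.map_comp]
    refine ⟨fun _ _ => trivial, fun x hx y hy h => ?_, fun z _ => ?_⟩
    · rw [e', e'] at h
      exact h1.1 (hb.injOn ((hCk x).mp hx) ((hCk y).mp hy) (h2.1 h))
    · obtain ⟨z, rfl⟩ := h2.2 z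
      obtain ⟨y, hy, rfl⟩ := hb.surjOn (Set.mem_univ z)
      obtain ⟨x, rfl⟩ := h1.2 y
      exact ⟨x, (hCk x).mpr hy, e' x⟩
  degeneracy k i := by
    intro x hx
    -- Stage `k + 2` is needed since a degeneracy ends in degree `k + 1`.
    rw [hC (k + 2) _ (Nat.lt_succ_self _), ← GeomPt.map_comp, (p (k + 2)).naturality,
      GeomPt.map_comp]
    exact (hA (k + 2)).degeneracy k i ((hC (k + 2) k (by omega) x).mp hx)

/-- The universal way of making a marked augmented simplicial scheme free on its marked
points. -/
lemma IsMarked.exists_free {P : AugSimplicialScheme.{u}} {B : Marking Ω P}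
    (hP : IsMarked P B) [hN : IsLocallyNoetherian (P.obj (op WithInitial.star))] :
    ∃ (L : AugSimplicialScheme.{u}) (C : Marking Ω L) (p : L ⟶ P), IsMarked L C ∧
      (∀ j, Free (L.obj (op (ord j))) (C j)) ∧
      IsIso (p.app (op WithInitial.star)) ∧ PreservesMarking C B p ∧
      ∀ {T : AugSimplicialScheme.{u}} {BT : Marking Ω T} (_ : IsMarked T BT)
        (_ : ∀ k, Free (T.obj (op (ord k))) (BT k)) (g : T ⟶ P) (_ : PreservesMarking BT B g),
        ∃ f : T ⟶ L, PreservesMarking BT C f ∧ f ≫ p = g := by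
  let Stage (n : ℕ) := {x : (Σ A : AugSimplicialScheme.{u}, Marking Ω A) // IsMarked x.1 x.2 ∧
    IsLocallyNoetherian (x.1.obj (op WithInitial.star)) ∧
    ∀ j < n, Free (x.1.obj (op (ord j))) (x.2 j)}
  have step (n : ℕ) (x : Stage n) : ∃ (y : Stage (n + 1)) (π : y.1.1 ⟶ x.1.1),
      (∀ k, below n k → IsIso (π.app (op k))) ∧ PreservesMarking y.1.2 x.1.2 π ∧
      (∀ j < n, ∀ z : GeomPt Ω (y.1.1.obj (op (ord j))), z.map (π.app (op (ord j))) ∈ x.1.2 j →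
        z ∈ y.1.2 j) ∧
      ∀ {T : AugSimplicialScheme.{u}} {BT : Marking Ω T} (_ : IsMarked T BT)
        (_ : ∀ k, Free (T.obj (op (ord k))) (BT k)) (g : T ⟶ x.1.1)
        (_ : PreservesMarking BT x.1.2 g),
        ∃ f : T ⟶ y.1.1, PreservesMarking BT y.1.2 f ∧ f ≫ π = g := by
    obtain ⟨⟨A, B⟩, hA, hN, hF⟩ := x
    obtain ⟨E, C, π, hE, hF', hπ, hπ', hC, hT⟩ := hA.exists_free_step hF
    have := hπ .star (below_star n)
    exact ⟨⟨⟨E, C⟩, hE, isLocallyNoetherian_of_isOpenImmersion (π.app (op .star)), hF'⟩, π, hπ,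
      hπ', hC, hT⟩
  choose next π hπ hπ' hC hT using step
  let st (n : ℕ) : Stage n := Nat.rec ⟨⟨P, B⟩, hP, hN, fun j hj => absurd hj (Nat.not_lt_zero j)⟩
    (fun n x => next n x) n
  obtain ⟨L, p, hp, hp', hL⟩ := exists_limit_tower (fun n => (st n).1.1) (fun n => π n (st n))
    fun n => hπ n (st n)
  -- Stage `k + 1` is where degree `k` has been made free; later transition maps are isomorphisms
  -- there and match the markings in both directions.
  let C : Marking Ω L := fun k => {x | x.map ((p (k + 1)).app (op (ord k))) ∈ (st (k + 1)).1.2 k}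
  have happ (n k : ℕ) (x : GeomPt Ω (L.obj (op (ord k)))) :
      (x.map ((p (n + 1)).app (op (ord k)))).map ((π n (st n)).app (op (ord k))) =
        x.map ((p n).app (op (ord k))) := by
    rw [← GeomPt.map_comp, ← hp n]
    rfl
  have hCk (n k : ℕ) (hk : k < n) (x : GeomPt Ω (L.obj (op (ord k)))) :
      x ∈ C k ↔ x.map ((p n).app (op (ord k))) ∈ (st n).1.2 k := by
    induction n, hk using Nat.le_induction with
    | base => exact Iff.rfl
    | succ n hk ih =>
      rw [ih]
      refine ⟨fun h => hC n (st n) k hk _ ?_, fun h => ?_⟩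
      · rw [happ]
        exact h
      · have := hπ' n (st n) k h
        rwa [happ] at this
  have hC0 (n k : ℕ) (x : GeomPt Ω (L.obj (op (ord k)))) (hx : x ∈ C k) :
      x.map ((p n).app (op (ord k))) ∈ (st n).1.2 k := by
    obtain h | h := lt_or_ge k n
    · exact (hCk n k h x).mp hx
    · have := Nat.decreasingInduction (motive := fun m _ =>
        x.map ((p m).app (op (ord k))) ∈ (st m).1.2 k) (fun m _ hm => by
          have := hπ' m (st m) k hm
          rwa [happ] at this) hx (h.trans (Nat.le_succ k))
      exact this
  refine ⟨L, C, p 0, .of_approximation (fun n => (st n).2.1) p hp' fun n k hk x => hCk n k hk x,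
    fun k => ?_, hp' 0 _ (below_star 0), fun k x hx => hC0 0 k x hx, fun {T BT} hTm hTF g hg => ?_⟩
  · have := hp' (k + 1) (ord k) (below_ord.mpr (Nat.lt_succ_self k))
    exact Free.of_isIso ((p (k + 1)).app (op (ord k)))
      ((st (k + 1)).2.2.2 k (Nat.lt_succ_self k)) fun x => hCk _ _ (Nat.lt_succ_self k) x
  · choose l hl hl' using fun n (g : {g : T ⟶ (st n).1.1 // PreservesMarking BT (st n).1.2 g}) =>
      hT n (st n) hTm hTF g.1 g.2
    let G (n : ℕ) : {g : T ⟶ (st n).1.1 // PreservesMarking BT (st n).1.2 g} :=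
      Nat.rec ⟨g, hg⟩ (fun n x => ⟨l n x, hl n x⟩) n
    obtain ⟨f, hf⟩ := hL (fun n => (G n).1) fun n => hl' n (G n)
    refine ⟨f, fun k x hx => ?_, hf 0⟩
    have e : (x.map (f.app (op (ord k)))).map ((p (k + 1)).app (op (ord k))) =
        x.map ((G (k + 1)).1.app (op (ord k))) := by
      rw [← GeomPt.map_comp, ← hf (k + 1)]
      rfl
    refine (hCk _ _ (Nat.lt_succ_self k) _).mpr ?_
    rw [e]
    exact (G (k + 1)).2 k hx

/-! ### Universal rigid hypercovers -/

/-- For maps `f j` from a locally Noetherian scheme `X` to finitely many schemes with rigid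
hypercovers `V j`, there is a rigid hypercover of `X` which is universal among those mapping to
each `V j` over `f j`. -/
lemma exists_universal_rigidHypercover (X : Scheme.{u}) [IsLocallyNoetherian X] {J : Type*}
    [Finite J] (V : J → RigidHypercover.{u} Ω) (f : ∀ j, X ⟶ (augmentation Ω).obj (V j)) :
    ∃ (W : RigidHypercover.{u} Ω) (e : (augmentation Ω).obj W ≅ X),
      (∀ j, ∃ p : W ⟶ V j, (augmentation Ω).map p = e.hom ≫ f j) ∧
      ∀ (T : RigidHypercover.{u} Ω) (h : (augmentation Ω).obj T ⟶ X),
        (∀ j, ∃ g : T ⟶ V j, (augmentation Ω).map g = h ≫ f j) →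
        ∃ g : T ⟶ W, (augmentation Ω).map g ≫ e.hom = h := by
  have := Fintype.ofFinite J
  obtain ⟨A, B, e, hA, hp, hu⟩ := exists_isMarked_finite V f Finset.univ
  have : IsLocallyNoetherian (A.obj (op WithInitial.star)) :=
    isLocallyNoetherian_of_isOpenImmersion e.hom
  obtain ⟨L, C, π, hL, hF, hπ, hπ', hu'⟩ := hA.exists_free
  obtain ⟨ε, hε⟩ : ∃ ε : L.obj (op WithInitial.star) ≅ X,
      ε.hom = π.app (op WithInitial.star) ≫ e.hom :=
    ⟨asIso (π.app (op WithInitial.star)) ≪≫ e, rfl⟩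
  obtain ⟨W, rfl, rfl⟩ := hL.exists_rigidHypercover hF
  refine ⟨W, ε, fun j => ?_, fun T h H => ?_⟩
  · obtain ⟨p, hp, hp'⟩ := hp j (Finset.mem_univ j)
    refine ⟨RigidHypercover.homOfPreservesMarking (π ≫ p) (hπ'.comp hp), ?_⟩
    have e' : (π ≫ p).app (op WithInitial.star) = ε.hom ≫ f j := by
      rw [NatTrans.comp_app, hp', hε]
      exact (Category.assoc _ _ _).symm
    exact e'
  · obtain ⟨g, hg, hg'⟩ := hu T.U T.marking h fun j _ => by
      obtain ⟨g, hg⟩ := H j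
      exact ⟨g.map, g.preservesMarking, hg⟩
    obtain ⟨l, hl, rfl⟩ := hu' T.isMarked T.free g hg
    refine ⟨RigidHypercover.homOfPreservesMarking l hl, ?_⟩
    refine Eq.trans (congrArg (l.app (op WithInitial.star) ≫ ·) hε) (Eq.trans ?_ hg')
    exact (Category.assoc _ _ _).symm

/-- A compatible system of finite families of rigid hypercovers is dominated by a rigid hypercover
of the simplicial scheme. -/
lemma exists_simplicialHRR (X : SimplicialObject Scheme.{u})
    (hX : ∀ m : ℕ, IsLocallyNoetherian (X.obj (op (SimplexCategory.mk m))))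
    {J : SimplexCategory → Type} [∀ k, Finite (J k)]
    (V : ∀ k, J k → RigidHypercover.{u} Ω)
    (f : ∀ k (j : J k), X.obj (op k) ⟶ (augmentation Ω).obj (V k j))
    (hf : ∀ {k l : SimplexCategory} (β : k ⟶ l) (j : J k), ∃ (j' : J l) (g : V l j' ⟶ V k j),
      f l j' ≫ (augmentation Ω).map g = X.map β.op ≫ f k j) :
    ∃ U : SimplicialHRR.{u} Ω X, ∀ k (j : J k), ∃ p : U.V.obj (op k) ⟶ V k j,
      (augmentation Ω).map p = U.e.hom.app (op k) ≫ f k j := by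
  have (k : SimplexCategory) : IsLocallyNoetherian (X.obj (op k)) := hX k.len
  choose W e hp hu using fun k => exists_universal_rigidHypercover (X.obj (op k)) (V k) (f k)
  have hmap {k l : SimplexCategory} (β : k ⟶ l) : ∃ g : W l ⟶ W k,
      (augmentation Ω).map g ≫ (e k).hom = (e l).hom ≫ X.map β.op := by
    refine hu k (W l) _ fun j => ?_
    obtain ⟨j', g, hg⟩ := hf β j
    obtain ⟨p, hp⟩ := hp l j'
    exact ⟨p ≫ g, by rw [Functor.map_comp, hp, Category.assoc, hg, Category.assoc]⟩
  -- Only existence of these maps is needed: the simplicial identities below follow from uniqueness.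
  choose g hg using @hmap
  let F : SimplexCategoryᵒᵖ ⥤ RigidHypercover.{u} Ω :=
    { obj k := W k.unop
      map β := g β.unop
      map_id k := RigidHypercover.hom_ext <| by
        rw [← cancel_mono (e k.unop).hom, hg, CategoryTheory.Functor.map_id, Category.id_comp]
        exact (congrArg _ (X.map_id k)).trans (Category.comp_id _)
      map_comp β γ := RigidHypercover.hom_ext <| by
        rw [← cancel_mono (e _).hom, hg, Functor.map_comp, Category.assoc, hg,
          reassoc_of% hg β.unop]
        exact congrArg _ (X.map_comp β γ) }
  exact ⟨⟨F, NatIso.ofComponents (fun k => e k.unop) fun β => hg β.unop⟩, hp⟩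

/-! ### Domination and common refinement -/

lemma HRR.hom_subsingleton {X : Scheme.{u}} (V W : HRR.{u} Ω X) (f g : V ⟶ W) : f = g :=
  HRR.Hom.ext <| RigidHypercover.hom_ext <| by
    rw [← cancel_mono W.e.hom]
    exact f.w.trans g.w.symm

lemma HRR.exists_hom {X : Scheme.{u}} (V W : HRR.{u} Ω X) (p : V.V ⟶ W.V)
    (h : (augmentation Ω).map p = V.e.hom ≫ W.e.inv) : Nonempty (V ⟶ W) :=
  ⟨⟨p, by rw [h, Category.assoc, Iso.inv_hom_id, Category.comp_id]⟩⟩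

lemma SimplicialHRR.exists_hom {X : SimplicialObject Scheme.{u}} (V W : SimplicialHRR.{u} Ω X)
    (h : ∀ k : SimplexCategory, ∃ p : V.V.obj (op k) ⟶ W.V.obj (op k),
      (augmentation Ω).map p = V.e.hom.app (op k) ≫ W.e.inv.app (op k)) : Nonempty (V ⟶ W) := by
  choose p hp using h
  refine ⟨⟨⟨fun k => p k.unop, fun k l β => RigidHypercover.hom_ext ?_⟩, ?_⟩⟩
  · rw [Functor.map_comp, Functor.map_comp, hp, hp]
    have h1 := V.e.hom.naturality β
    have h2 := W.e.inv.naturality β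
    rw [Functor.comp_map] at h1 h2
    rw [Category.assoc]
    refine (reassoc_of% h1) _ |>.trans ?_
    exact congrArg _ h2
  · ext k : 2
    change (augmentation Ω).map (p k.unop) ≫ W.e.hom.app k = V.e.hom.app k
    rw [hp]
    refine (Category.assoc _ _ _).trans ?_
    exact (congrArg _ (W.e.inv_hom_id_app k)).trans (Category.comp_id _)

/-- Any two rigid hypercovers of a simplicial scheme have a common refinement. -/
lemma SimplicialHRR.exists_common_refinement {X : SimplicialObject Scheme.{u}}
    (hX : ∀ m : ℕ, IsLocallyNoetherian (X.obj (op (SimplexCategory.mk m))))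
    (V W : SimplicialHRR.{u} Ω X) :
    ∃ U : SimplicialHRR.{u} Ω X, Nonempty (U ⟶ V) ∧ Nonempty (U ⟶ W) := by
  let c (b : Bool) : SimplicialHRR.{u} Ω X := if b then V else W
  obtain ⟨U, hU⟩ := exists_simplicialHRR X hX (J := fun _ => Bool)
    (fun k b => (c b).V.obj (op k)) (fun k b => (c b).e.inv.app (op k))
    (fun β b => ⟨b, (c b).V.map β.op, ((c b).e.inv.naturality β.op).symm⟩)
  exact ⟨U, SimplicialHRR.exists_hom U (c true) fun k => hU k true,
    SimplicialHRR.exists_hom U (c false) fun k => hU k false⟩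

/-- At `[k]` the family consists of the `d m` along all maps `[m] ⟶ [k]` with `m ≤ n`: it is finite,
and composition with `[k] ⟶ [l]` makes it compatible. The index given by the identity of `[m]`
yields the map to `d m`. -/
lemma SimplicialHRR.exists_forgetHRR_hom {X : SimplicialObject Scheme.{u}}
    (hX : ∀ m : ℕ, IsLocallyNoetherian (X.obj (op (SimplexCategory.mk m)))) (n : ℕ)
    (d : (m : Fin (n + 1)) → HRR.{u} Ω (X.obj (op (SimplexCategory.mk (m : ℕ))))) :
    ∃ U : SimplicialHRR.{u} Ω X, Nonempty ((forgetHRR Ω X n).obj U ⟶ d) := by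
  have (k : SimplexCategory) : Finite (Σ m : Fin (n + 1), (SimplexCategory.mk (m : ℕ) ⟶ k)) :=
    inferInstance
  obtain ⟨U, hU⟩ := exists_simplicialHRR X hX
    (J := fun k => Σ m : Fin (n + 1), (SimplexCategory.mk (m : ℕ) ⟶ k))
    (fun _ j => (d j.1).V) (fun _ j => X.map j.2.op ≫ (d j.1).e.inv)
    (fun β j => ⟨⟨j.1, j.2 ≫ β⟩, 𝟙 _, by
      rw [CategoryTheory.Functor.map_id, Category.comp_id, op_comp, X.map_comp, Category.assoc]⟩)
  have h (m : Fin (n + 1)) : Nonempty ((evalHRR Ω X m).obj U ⟶ d m) := by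
    obtain ⟨p, hp⟩ := hU (SimplexCategory.mk (m : ℕ)) ⟨m, 𝟙 _⟩
    refine HRR.exists_hom _ _ p (hp.trans ?_)
    rw [op_id, X.map_id, Category.id_comp]
    rfl
  exact ⟨U, ⟨fun m => (h m).some⟩⟩

end RigidHyper

/-- For a simplicial scheme `X` whose terms are locally Noetherian, and separably closed fields
`Ω i` large enough for every point of every `X_m` to underlie a geometric point, the forgetful
functor `HRR(X) ⥤ HRR(X_0) × ⋯ × HRR(X_n)` is cofinal (in the sense of cofiltered index
categories, which Mathlib calls initial). -/
theorem mainTheorem9 {I : Type u} (Ω : I → Type u) [∀ i, Field (Ω i)] [∀ i, IsSepClosed (Ω i)]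
    (X : SimplicialObject Scheme.{u})
    (hX : ∀ m : ℕ, IsLocallyNoetherian (X.obj (op (SimplexCategory.mk m))))
    (hΩ : ∀ (m : ℕ) (x : X.obj (op (SimplexCategory.mk m))),
      ∃ i, Nonempty ((X.obj (op (SimplexCategory.mk m))).residueField x →+* Ω i))
    (n : ℕ) :
    (RigidHyper.forgetHRR Ω X n).Initial := by
  refine ⟨fun d => ?_⟩
  obtain ⟨U, ⟨u⟩⟩ := RigidHyper.SimplicialHRR.exists_forgetHRR_hom hX n d
  have : Nonempty (CostructuredArrow (RigidHyper.forgetHRR Ω X n) d) :=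
    ⟨CostructuredArrow.mk u⟩
  refine zigzag_isConnected fun a b => ?_
  obtain ⟨c, ⟨f⟩, ⟨g⟩⟩ := RigidHyper.SimplicialHRR.exists_common_refinement hX a.left b.left
  -- The target is a preorder, so the common refinement `c` of `a` and `b` automatically maps to
  -- both over `d`.
  have hom_eq (v w : (RigidHyper.forgetHRR Ω X n).obj c ⟶ d) : v = w :=
    funext fun m => RigidHyper.HRR.hom_subsingleton _ _ _ _
  let c' : CostructuredArrow (RigidHyper.forgetHRR Ω X n) d :=
    CostructuredArrow.mk ((RigidHyper.forgetHRR Ω X n).map f ≫ a.hom)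
  exact Zigzag.of_inv_hom (j₂ := c') (CostructuredArrow.homMk f (hom_eq _ _))
    (CostructuredArrow.homMk g (hom_eq _ _))
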